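/- Let $-\infty<a<b<\infty$, $\mu,\beta,\sigma,w\in\mathbb{C}$ and $\alpha,\eta,\nu\in\mathbb{R}$ with $\Re(\mu)>0$, $\Re(\beta)>0$, $w\neq 0$, $\alpha>0$, $\eta>0$, $\Re(\sigma)>1/\eta-1$, and put $N=[\Re(\mu)]+1$. For $\Re(\kappa)>0$ let $(I^{\kappa}_{a+}f)(x)=\frac1{\Gamma(\kappa)}\int_a^x (x-t)^{\kappa-1}f(t)\,dt$, and let $D^{\mu}_{a+}f=\left(\frac{d}{dx}\right)^{N}I^{N-\mu}_{a+}f$. Let $H^{m,n}_{p,q}[z]=\frac1{2\pi i}\int_L\frac{\prod_{j=1}^m\Gamma(b_j-\beta_j\xi)\prod_{j=1}^n\Gamma(1-a_j+\alpha_j\xi)}{\prod_{j=m+1}^q\Gamma(1-b_j+\beta_j\xi)\prod_{j=n+1}^p\Gamma(a_j-\alpha_j\xi)}\,z^\xi\,d\xi$ be Fox's $H$-function with upper parameters $(a_j,\alpha_j)_{1,p}$ and lower parameters $(b_j,\beta_j)_{1,q}$, where $z^\xi$ is the principal power and $L$ is a loop, starting and ending at $+\infty$, that separates the poles of the $\Gamma(b_j-\beta_j\xi)$,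 $j\le m$ (enclosed, clockwise), from those of the $\Gamma(1-a_j+\alpha_j\xi)$, $j\le n$ (left outside); for the parameters below the integral converges for every $z\ne0$. Put $$\left(\mathcal{H}^{w;m,n;\alpha}_{a+;p,q;\beta}\varphi\right)(x)=\int_a^x (x-t)^{\beta-1}H^{m,n}_{p,q}[w(x-t)^\alpha]\varphi(t)\,dt .$$ Let $\mathcal{H}^{w;2,0;\alpha}_{a+;1,2;\beta}$ be the operator with the kernel of the generalized Macdonald function $\lambda^{(\eta)}_{\sigma,\nu}$, that is, with upper parameter $\left(1-\frac{\nu+1}{\eta},\frac1\eta\right)$ and lower parameters $(0,1),\left(-\sigma-\frac{\nu}{\eta},\frac1\eta\right)$. Let $\mathcal{H}^{w;2,2;\alpha}_{a+;3,4;\beta-\mu}$ be the operator with upper parameters $(1-\beta-N+\mu,\alpha),(1-\beta,\alpha),\left(1-\frac{\nu+1}{\eta},\frac1\eta\right)$ and lower parameters $(0,1),\left(-\sigma-\frac{\nu}{\eta},\frac1\eta\right),(1-\beta-N+\mu,\alpha),(1-\beta+\mu,\alpha)$. Suppose that the parametric conditions for both operators hold: $\Re(\beta)+\alpha\min\{0,-\eta\Re(\sigma)-\nu\}>0$,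 $\Re(\beta-\mu)>0$ and $\Re(\beta-\mu)+\alpha\min\{0,-\eta\Re(\sigma)-\nu\}>0$. Let $\phi:(a,b)\to\mathbb{C}$ be integrable and such that $g=I^{N-\mu}_{a+}\phi$ has locally absolutely continuous derivatives $g,g',\dots,g^{(N-1)}$ on $(a,b)$, that $D^\mu_{a+}\phi=g^{(N)}$ is integrable on $(a,b)$, and that $\lim_{x\to a+}g^{(k)}(x)=0$ for $0\le k\le N-1$. Then $$\left(\mathcal{H}^{w;2,0;\alpha}_{a+;1,2;\beta}D^{\mu}_{a+}\phi\right)(x)=\left(\mathcal{H}^{w;2,2;\alpha}_{a+;3,4;\beta-\mu}\phi\right)(x),$$ with both integrals absolutely convergent, for almost every $x\in(a,b)$, and for every $x\in(a,b]$ such that $D^\mu_{a+}\phi$ is essentially bounded on some interval $(c,x)$, $a\le c<x$ (in particular, if $D^\mu_{a+}\phi$ is continuous on $(a,b]$, for every $x\in(a,b]$). -/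

import Mathlib

open MeasureTheory Filter Topology

/-- The Riemann-Liouville fractional integral
`(I^μ_{a+} f)(x) = Γ(μ)⁻¹ ∫_a^x (x - t)^(μ - 1) f(t) dt`, of complex order `μ` with `Re μ > 0`. -/
noncomputable def rlIntegral (a : ℝ) (μ : ℂ) (f : ℝ → ℂ) (x : ℝ) : ℂ :=
  1 / Complex.Gamma μ * ∫ t in a..x, f t / ((x - t : ℝ) : ℂ) ^ (1 - μ)

/-- The number `[Re μ] + 1` of derivatives in the Riemann-Liouville derivative of order `μ`. -/
noncomputable def rlOrder (μ : ℂ) : ℕ := ⌊μ.re⌋₊ + 1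

/-- The Riemann-Liouville fractional derivative `D^μ_{a+} f = (d/dx)^N I^{N-μ}_{a+} f`, where
`N = [Re μ] + 1`. -/
noncomputable def rlDeriv (a : ℝ) (μ : ℂ) (f : ℝ → ℂ) (x : ℝ) : ℂ :=
  iteratedDeriv (rlOrder μ) (rlIntegral a ((rlOrder μ : ℂ) - μ) f) x

/-- The functions on `(a, b)` to which the derivative `D^μ_{a+}` is applied. With
`N = [Re μ] + 1` and `g = I^{N-μ}_{a+} f`: `f` is integrable, the derivatives
`g, g', ..., g^(N-1)` are locally absolutely continuous on `(a, b)`, the derivative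
`D^μ_{a+} f = g^(N)` is integrable, and the initial values `g^(k)(a+)`, `k < N`, vanish. -/
structure IsRLDifferentiable (a b : ℝ) (μ : ℂ) (f : ℝ → ℂ) : Prop where
  integrable : IntegrableOn f (Set.Ioo a b)
  absCont : ∀ k < rlOrder μ, ∀ c d : ℝ, a < c → c ≤ d → d < b →
    AbsolutelyContinuousOnInterval
      (iteratedDeriv k (rlIntegral a ((rlOrder μ : ℂ) - μ) f)) c d
  integrable_deriv : IntegrableOn (rlDeriv a μ f) (Set.Ioo a b)
  initial : ∀ k < rlOrder μ,
    Tendsto (iteratedDeriv k (rlIntegral a ((rlOrder μ : ℂ) - μ) f)) (𝓝[>] a) (𝓝 0)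

/-- The quotient of Gamma factors in the Mellin-Barnes integral of the `H`-function with upper
parameters `A j = (a_j, α_j)` and lower parameters `B j = (b_j, β_j)` (indices start at `0`):
`∏_{j<m} Γ(b_j - β_j ξ) ∏_{j<n} Γ(1 - a_j + α_j ξ)` divided by
`∏_{m≤j<q} Γ(1 - b_j + β_j ξ) ∏_{n≤j<p} Γ(a_j - α_j ξ)`. -/
noncomputable def foxKernel {p q : ℕ} (m n : ℕ) (A : Fin p → ℂ × ℝ) (B : Fin q → ℂ × ℝ)
    (ξ : ℂ) : ℂ :=
  (∏ j : Fin q, if (j : ℕ) < m then Complex.Gamma ((B j).1 - (B j).2 * ξ)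
    else 1 / Complex.Gamma (1 - (B j).1 + (B j).2 * ξ)) *
  (∏ j : Fin p, if (j : ℕ) < n then Complex.Gamma (1 - (A j).1 + (A j).2 * ξ)
    else 1 / Complex.Gamma ((A j).1 - (A j).2 * ξ))

/-- `c` and `T` describe an admissible loop for the `H`-function: the loop that comes from
`+∞ - iT`, goes to `c - iT`, up to `c + iT`, and back to `+∞ + iT` encloses all the poles
`(b_j + k) / β_j` of the factors `Γ(b_j - β_j ξ)`, `j < m`, and leaves all the poles
`(a_j - 1 - k) / α_j` of the factors `Γ(1 - a_j + α_j ξ)`, `j < n`, on its left. -/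
structure IsFoxLoop {p q : ℕ} (m n : ℕ) (A : Fin p → ℂ × ℝ) (B : Fin q → ℂ × ℝ)
    (c T : ℝ) : Prop where
  pos : 0 < T
  right : ∀ j : Fin q, (j : ℕ) < m →
    c < ((B j).1 / ((B j).2 : ℂ)).re ∧ |((B j).1 / ((B j).2 : ℂ)).im| < T
  left : ∀ j : Fin p, (j : ℕ) < n → (((A j).1 - 1) / ((A j).2 : ℂ)).re < c

/-- `(2πi)⁻¹ ∫_L F(ξ) dξ` along the loop `L` from `+∞ - iT` through `c - iT` and `c + iT` to
`+∞ + iT`. -/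
noncomputable def loopIntegral (c T : ℝ) (F : ℂ → ℂ) : ℂ :=
  1 / (2 * Real.pi * Complex.I) *
    (-(∫ s in Set.Ioi c, F ((s : ℂ) - T * Complex.I)) +
      Complex.I * (∫ y in (-T)..T, F ((c : ℂ) + y * Complex.I)) +
      ∫ s in Set.Ioi c, F ((s : ℂ) + T * Complex.I))

open Classical in
/-- Fox's `H`-function `H^{m,n}_{p,q}[z] = (2πi)⁻¹ ∫_L φ(ξ) z^ξ dξ` for `z ≠ 0`, in the case
`∑ β_j > ∑ α_j`, in which the integral over the loop `L` around the poles of the factors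
`Γ(b_j - β_j ξ)` converges for every `z ≠ 0` and, by Cauchy's theorem, does not depend on the
admissible loop; `z^ξ` is the principal power. -/
noncomputable def foxH {p q : ℕ} (m n : ℕ) (A : Fin p → ℂ × ℝ) (B : Fin q → ℂ × ℝ)
    (z : ℂ) : ℂ :=
  if h : ∃ L : ℝ × ℝ, IsFoxLoop m n A B L.1 L.2 then
    loopIntegral h.choose.1 h.choose.2 (fun ξ => foxKernel m n A B ξ * z ^ ξ)
  else 0

/-- The integrand `(x - t)^(β - 1) H^{m,n}_{p,q}[w (x - t)^α] φ(t)`. -/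
noncomputable def foxIntegrand {p q : ℕ} (w : ℂ) (m n : ℕ) (α : ℝ)
    (A : Fin p → ℂ × ℝ) (B : Fin q → ℂ × ℝ) (β : ℂ) (φ : ℝ → ℂ) (x t : ℝ) : ℂ :=
  ((x - t : ℝ) : ℂ) ^ (β - 1) * foxH m n A B (w * (((x - t) ^ α : ℝ) : ℂ)) * φ t

/-- The operator `H^{w;m,n;α}_{a+;p,q;β}`, with the `H`-function with parameters `A`, `B` in its
kernel, applied to `φ`. -/
noncomputable def foxOperator {p q : ℕ} (a : ℝ) (w : ℂ) (m n : ℕ) (α : ℝ)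
    (A : Fin p → ℂ × ℝ) (B : Fin q → ℂ × ℝ) (β : ℂ) (φ : ℝ → ℂ) (x : ℝ) : ℂ :=
  ∫ t in a..x, foxIntegrand w m n α A B β φ x t

/-- The upper parameter of the generalized Macdonald function
`λ^{(η)}_{σ,ν}[z] = H^{2,0}_{1,2}[z]`. -/
noncomputable def macdonaldUpper (η ν : ℝ) : Fin 1 → ℂ × ℝ :=
  ![(1 - ((ν : ℂ) + 1) / (η : ℂ), 1 / η)]

/-- The lower parameters of the generalized Macdonald function
`λ^{(η)}_{σ,ν}[z] = H^{2,0}_{1,2}[z]`. -/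
noncomputable def macdonaldLower (η : ℝ) (σ : ℂ) (ν : ℝ) : Fin 2 → ℂ × ℝ :=
  ![(0, 1), (-σ - (ν : ℂ) / (η : ℂ), 1 / η)]

/-- The upper parameters `(1 - β - N + μ, α), (1 - β, α), (a_1, α_1)` of the function
`H^{2,2}_{3,4}`, where `N = [Re μ] + 1` and `(a_1, α_1)` is the upper parameter of the
generalized Macdonald function. -/
noncomputable def composedUpper (η ν α : ℝ) (β μ : ℂ) : Fin 3 → ℂ × ℝ :=
  ![(1 - β - (rlOrder μ : ℂ) + μ, α), (1 - β, α),
    (1 - ((ν : ℂ) + 1) / (η : ℂ), 1 / η)]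

/-- The lower parameters `(b_1, β_1), (b_2, β_2), (1 - β - N + μ, α), (1 - β + μ, α)` of the
function `H^{2,2}_{3,4}`, where `N = [Re μ] + 1` and `(b_1, β_1), (b_2, β_2)` are the lower
parameters of the generalized Macdonald function. -/
noncomputable def composedLower (η : ℝ) (σ : ℂ) (ν α : ℝ) (β μ : ℂ) : Fin 4 → ℂ × ℝ :=
  ![(0, 1), (-σ - (ν : ℂ) / (η : ℂ), 1 / η),
    (1 - β - (rlOrder μ : ℂ) + μ, α), (1 - β + μ, α)]

/-!
Write `k * f` for the convolution `∫_a^x k(x - t) f(t) dt`, and put `p_μ(u) = u ^ (μ - 1) / Γ(μ)`,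
`k₁(u) = u ^ (β - 1) H¹[w u ^ α]` and `k₂(u) = u ^ (β - μ - 1) H²[w u ^ α]`, where `H¹ =
H^{2,0}_{1,2}` and `H² = H^{2,2}_{3,4}`. The theorem is `k₁ * D^μ φ = k₂ * φ`, and it is the chain
`k₁ * D^μ φ = (k₂ * p_μ) * D^μ φ = k₂ * (p_μ * D^μ φ) = k₂ * φ`.

The first equality is `k₁ = k₂ * p_μ` (`volterra_mellinKer_rlKer`). On a loop where `Re (β - μ +
αξ) > 0`, the Beta integral turns `u ^ (β - μ + αξ - 1)` into `Γ(β - μ + αξ) / Γ(β + αξ) · u ^ (β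
+ αξ - 1)`, and this quotient of Gamma factors is exactly what distinguishes the two Mellin-Barnes
kernels (`foxKernel_composed`). The parametric condition on `β - μ` says that such a loop exists
among the admissible ones. As the definition of the `H`-function uses an arbitrary admissible
loop, Cauchy's theorem is needed to pass to this one (`LoopKernel.foxH_eq`); it rests on the
superexponential decay of the kernels in horizontal strips (`loopKernel_macdonald`,
`loopKernel_composed`), which comes from the reflection formula, the factorial growth of `Γ` and a
Beta integral bound for quotients of Gamma functions.

The second equality is Fubini's theorem (`PowerBound.volterra_assoc`). On bounded intervals `k₂(u)
= O(u ^ (r - 1))` with `r = Re (β - μ) + αc > 0`, where `c` is the abscissa of the loop, so it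
holds at every `x` where `|D^μ φ|` has a finite convolution with `u ^ (r + Re μ - 1)`: almost
everywhere, because the power is locally integrable, and wherever `D^μ φ` is essentially bounded
to the left of `x`.

The third equality is `I^μ D^μ φ = φ` a.e. (`ae_eq_volterra_rlDeriv`), which is where local
absolute continuity and the vanishing initial values enter.
-/

/-! ### Convolution with kernels supported on the half-line -/

/-- The convolution `(k * f)(x) = ∫ k(x - t) f(t) dt` over the whole line. Kernels vanish on `(-∞,
0]` and functions vanish outside `(a, b)`, so for `x ≤ b` this is the Volterra integral `∫_a^x k(x
- t) f(t) dt`. -/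
noncomputable def volterra (k f : ℝ → ℂ) (x : ℝ) : ℂ := ∫ t, k (x - t) * f t

/-- The power `u ^ (κ - 1)` on `u > 0`, extended by zero. -/
noncomputable def posPow (κ : ℂ) (u : ℝ) : ℂ := if 0 < u then (u : ℂ) ^ (κ - 1) else 0

/-- The absolute value of `posPow κ` for `Re κ = r`, as an extended nonnegative real. -/
noncomputable def posPowE (r u : ℝ) : ENNReal := if 0 < u then ENNReal.ofReal (u ^ (r - 1)) else 0

/-- `k` is measurable and `|k(u)| ≤ C u ^ (r - 1)` on `(0, L)`. The bound includes `u ≤ 0`, where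
it says that `k` vanishes; nothing is asked for beyond `L`, which convolutions on an interval of
length `L` do not see. -/
structure PowerBound (L r : ℝ) (k : ℝ → ℂ) : Prop where
  measurable : Measurable k
  bound : ∃ C : ENNReal, C ≠ ⊤ ∧ ∀ u < L, ‖k u‖ₑ ≤ C * posPowE r u

lemma measurable_posPow (κ : ℂ) : Measurable (posPow κ) := by
  unfold posPow
  refine Measurable.ite measurableSet_Ioi ?_ measurable_const
  fun_prop

lemma measurable_posPowE (r : ℝ) : Measurable (posPowE r) := by
  unfold posPowE
  refine Measurable.ite measurableSet_Ioi ?_ measurable_const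
  fun_prop

lemma posPowE_ne_top (r u : ℝ) : posPowE r u ≠ ⊤ := by
  unfold posPowE; split_ifs <;> simp

lemma enorm_posPow (κ : ℂ) (u : ℝ) : ‖posPow κ u‖ₑ = posPowE κ.re u := by
  unfold posPow posPowE
  split_ifs with h
  · rw [← ofReal_norm, Complex.norm_cpow_eq_rpow_re_of_pos h]; simp
  · simp

lemma powerBound_posPow (L : ℝ) (κ : ℂ) : PowerBound L κ.re (posPow κ) :=
  ⟨measurable_posPow κ, 1, by simp, fun u _ => by rw [enorm_posPow, one_mul]⟩

lemma PowerBound.const_mul {L r : ℝ} {k : ℝ → ℂ} (h : PowerBound L r k) (z : ℂ) :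
    PowerBound L r (fun u => z * k u) := by
  obtain ⟨hm, C, hC, hb⟩ := h
  refine ⟨hm.const_mul z, ‖z‖ₑ * C, ENNReal.mul_ne_top (by simp) hC, fun u hu => ?_⟩
  rw [enorm_mul, mul_assoc]
  gcongr
  exact hb u hu

/-- The Beta integral rescaled from `(0, 1)` to `(0, u)` converges. -/
lemma integrableOn_betaIntegrand {s t : ℂ} (hs : 0 < s.re) (ht : 0 < t.re) {u : ℝ} (hu : 0 < u) :
    IntegrableOn (fun y : ℝ => (y : ℂ) ^ (s - 1) * ((u : ℂ) - y) ^ (t - 1)) (Set.Ioo 0 u) := by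
  have h := (Complex.betaIntegral_convergent hs ht).comp_mul_left (c := u⁻¹)
  rw [zero_div, one_div, inv_inv, intervalIntegrable_iff_integrableOn_Ioo_of_le hu.le] at h
  refine IntegrableOn.congr_fun (h.const_mul ((u : ℂ) ^ (s - 1) * (u : ℂ) ^ (t - 1)))
    (fun y hy => ?_) measurableSet_Ioo
  have h1 : (u : ℂ) ^ (s - 1) * ((u⁻¹ * y : ℝ) : ℂ) ^ (s - 1) = (y : ℂ) ^ (s - 1) := by
    rw [← Complex.mul_cpow_ofReal_nonneg hu.le (by have := hy.1; positivity), ← Complex.ofReal_mul,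
      mul_inv_cancel_left₀ hu.ne']
  have h2 : (u : ℂ) ^ (t - 1) * (1 - ((u⁻¹ * y : ℝ) : ℂ)) ^ (t - 1) = ((u : ℂ) - y) ^ (t - 1) := by
    have e : (0 : ℝ) ≤ 1 - u⁻¹ * y := by
      rw [sub_nonneg, inv_mul_le_one₀ hu]; exact hy.2.le
    rw [show (1 - ((u⁻¹ * y : ℝ) : ℂ)) = ((1 - u⁻¹ * y : ℝ) : ℂ) by push_cast; ring,
      ← Complex.mul_cpow_ofReal_nonneg hu.le e, ← Complex.ofReal_mul, mul_sub, mul_one,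
      mul_inv_cancel_left₀ hu.ne']
    push_cast; rfl
  rw [← h1, ← h2]; ring

lemma posPow_mul_posPow (κ τ : ℂ) (u : ℝ) :
    (fun y => posPow κ (u - y) * posPow τ y) =
      (Set.Ioo 0 u).indicator (fun y : ℝ => (y : ℂ) ^ (τ - 1) * ((u : ℂ) - y) ^ (κ - 1)) := by
  ext y
  unfold posPow Set.indicator
  by_cases h1 : 0 < y <;> by_cases h2 : y < u <;> simp [h1, h2, mul_comm]

lemma integrable_posPow_mul_posPow {κ τ : ℂ} (hκ : 0 < κ.re) (hτ : 0 < τ.re) (u : ℝ) :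
    Integrable (fun y => posPow κ (u - y) * posPow τ y) := by
  rw [posPow_mul_posPow, integrable_indicator_iff measurableSet_Ioo]
  rcases le_or_gt u 0 with hu | hu
  · simp [Set.Ioo_eq_empty_of_le hu]
  · exact integrableOn_betaIntegrand hτ hκ hu

lemma volterra_posPow (κ τ : ℂ) (u : ℝ) :
    volterra (posPow κ) (posPow τ) u = Complex.betaIntegral τ κ * posPow (κ + τ) u := by
  unfold volterra
  rw [posPow_mul_posPow, integral_indicator measurableSet_Ioo, posPow]
  split_ifs with hu
  · rw [← integral_Ioc_eq_integral_Ioo, ← intervalIntegral.integral_of_le hu.le,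
      Complex.betaIntegral_scaled _ _ hu, mul_comm, add_comm τ]
  · rw [Set.Ioo_eq_empty_of_le (not_lt.1 hu)]; simp

lemma posPow_ofReal (r u : ℝ) : posPow (r : ℂ) u = (‖posPow (r : ℂ) u‖ : ℝ) := by
  unfold posPow
  split_ifs with h
  · rw [Complex.norm_cpow_eq_rpow_re_of_pos h, Complex.ofReal_cpow h.le]; simp
  · simp

/-- The Beta integral for absolute values, in the translated form needed in Tonelli's theorem. -/
lemma lintegral_posPowE_mul {r s : ℝ} (hr : 0 < r) (hs : 0 < s) (x v : ℝ) :
    ∫⁻ t, posPowE r (x - t) * posPowE s (t - v) =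
      ‖Complex.betaIntegral s r‖ₑ * posPowE (r + s) (x - v) := by
  have h0 := lintegral_add_right_eq_self (μ := volume)
    (fun t => posPowE r (x - t) * posPowE s (t - v)) v
  rw [← h0]
  have h1 : (fun y => posPow r (x - v - y) * posPow s y) =
      fun y => ((‖posPow r (x - v - y) * posPow s y‖ : ℝ) : ℂ) := by
    ext y
    rw [norm_mul, Complex.ofReal_mul, ← posPow_ofReal, ← posPow_ofReal]
  have hi := integrable_posPow_mul_posPow (κ := r) (τ := s) (by simpa) (by simpa) (x - v)
  calc _ = ∫⁻ y, ‖posPow r (x - v - y) * posPow s y‖ₑ := by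
        congr 1; ext y
        rw [enorm_mul, enorm_posPow, enorm_posPow]; simp [sub_sub, add_comm]
    _ = ENNReal.ofReal ‖∫ y, posPow r (x - v - y) * posPow s y‖ := by
        rw [← ofReal_integral_norm_eq_lintegral_enorm hi]
        congr 1
        conv_rhs => rw [h1, integral_complex_ofReal]
        rw [Complex.norm_real, Real.norm_of_nonneg (integral_nonneg fun _ => norm_nonneg _)]
    _ = _ := by
        change ENNReal.ofReal ‖volterra (posPow r) (posPow s) (x - v)‖ = _
        rw [volterra_posPow, ofReal_norm, enorm_mul, enorm_posPow]; simp

/-- Associativity of convolution at a single point `x`, by Fubini's theorem, with absolute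
convergence of both outer integrals. -/
lemma volterra_assoc {k q f : ℝ → ℂ} (hk : Measurable k) (hq : Measurable q)
    (hf : AEStronglyMeasurable f) {x : ℝ}
    (h : ∫⁻ s, ∫⁻ t, ‖k (x - t)‖ₑ * ‖q (t - s)‖ₑ * ‖f s‖ₑ < ⊤) :
    volterra k (volterra q f) x = volterra (volterra k q) f x ∧
      Integrable (fun t => k (x - t) * volterra q f t) ∧
      Integrable (fun s => volterra k q (x - s) * f s) := by
  have hi : Integrable (fun p : ℝ × ℝ => k (x - p.2) * q (p.2 - p.1) * f p.1)
      (volume.prod volume) := by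
    have hm : AEStronglyMeasurable (fun p : ℝ × ℝ => k (x - p.2) * q (p.2 - p.1) * f p.1)
      (volume.prod volume) := by
      refine AEStronglyMeasurable.mul (Measurable.aestronglyMeasurable (by fun_prop)) hf.comp_fst
    refine ⟨hm, ?_⟩
    rw [hasFiniteIntegral_iff_enorm, lintegral_prod _ hm.enorm]
    simpa only [enorm_mul] using h
  have e1 : ∀ t, ∫ s, k (x - t) * q (t - s) * f s = k (x - t) * volterra q f t := by
    intro t
    rw [volterra, ← integral_const_mul]; simp only [mul_assoc]
  have e2 : ∀ s, ∫ t, k (x - t) * q (t - s) * f s = volterra k q (x - s) * f s := by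
    intro s
    rw [integral_mul_const, volterra]
    congr 1
    rw [← integral_add_right_eq_self _ s]
    simp [sub_sub, add_comm]
  refine ⟨?_, ?_, ?_⟩
  · have := integral_integral_swap (f := fun s t => k (x - t) * q (t - s) * f s) hi
    simp only [e1, e2] at this
    exact this.symm
  · have := hi.integral_prod_right
    simpa only [e1] using this
  · have := hi.integral_prod_left
    simpa only [e2] using this

/-- For power-bounded kernels, associativity at `x` needs only that `|f|` has a finite convolution
with `u ^ (r + s - 1)` at `x`: integrating out the middle variable gives a Beta integral. -/
lemma PowerBound.volterra_assoc {a b r s : ℝ} {k q f : ℝ → ℂ} (hk : PowerBound (b - a) r k)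
    (hq : PowerBound (b - a) s q) (hr : 0 < r) (hs : 0 < s) (hab : a < b)
    (hf : AEStronglyMeasurable f) (hsupp : ∀ t ∉ Set.Ioo a b, f t = 0) {x : ℝ} (hx : x ≤ b)
    (h : ∫⁻ v, posPowE (r + s) (x - v) * ‖f v‖ₑ < ⊤) :
    volterra k (volterra q f) x = volterra (volterra k q) f x ∧
      Integrable (fun t => k (x - t) * volterra q f t) ∧
      Integrable (fun s => volterra k q (x - s) * f s) := by
  obtain ⟨hkm, C, hC, hkb⟩ := hk
  obtain ⟨hqm, D, hD, hqb⟩ := hq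
  refine _root_.volterra_assoc hkm hqm hf (lt_of_le_of_lt (b := ∫⁻ v, (C * D *
    ‖Complex.betaIntegral s r‖ₑ) * (posPowE (r + s) (x - v) * ‖f v‖ₑ)) ?_ ?_)
  · refine lintegral_mono fun v => ?_
    have : ∀ t, ‖k (x - t)‖ₑ * ‖q (t - v)‖ₑ * ‖f v‖ₑ ≤
        C * D * (posPowE r (x - t) * posPowE s (t - v)) * ‖f v‖ₑ := by
      intro t
      -- off `a < v < t < x ≤ b` a factor vanishes; otherwise `x - t` and `t - v` are below `b - a`
      by_cases hv : v ∈ Set.Ioo a b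
      · rcases le_or_gt t v with h1 | h1
        · have := hqb (t - v) (by linarith)
          rw [posPowE, if_neg (by linarith), mul_zero, nonpos_iff_eq_zero] at this
          simp [this]
        rcases le_or_gt x t with h2 | h2
        · have := hkb (x - t) (by linarith)
          rw [posPowE, if_neg (by linarith), mul_zero, nonpos_iff_eq_zero] at this
          simp [this]
        · have := hv.1
          grw [hqb (t - v) (by linarith), hkb (x - t) (by linarith)]
          apply le_of_eq; ring
      · simp [hsupp v hv]
    refine (lintegral_mono this).trans (le_of_eq ?_)
    have m1 := measurable_posPowE r
    have m2 := measurable_posPowE s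
    rw [lintegral_mul_const _ (by fun_prop), lintegral_const_mul _ (by fun_prop),
      lintegral_posPowE_mul hr hs]
    ring
  · rw [lintegral_const_mul' _ _ (ENNReal.mul_ne_top (ENNReal.mul_ne_top hC hD) (by simp))]
    exact ENNReal.mul_lt_top
      (ENNReal.mul_lt_top (ENNReal.mul_lt_top hC.lt_top hD.lt_top) (by simp)) h

lemma lintegral_posPowE_lt_top {r : ℝ} (hr : 0 < r) (L : ℝ) :
    ∫⁻ u in Set.Iio L, posPowE r u < ⊤ := by
  have h1 : (Set.Iio L).indicator (posPowE r) =
      (Set.Ioo 0 L).indicator (fun u => ‖u ^ (r - 1)‖ₑ) := by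
    ext u
    by_cases h1 : 0 < u <;> by_cases h2 : u < L <;> simp [posPowE, h1, h2, Set.indicator]
    rw [Real.enorm_of_nonneg (by positivity)]
  rw [← lintegral_indicator measurableSet_Iio, h1, lintegral_indicator measurableSet_Ioo]
  rcases le_or_gt L 0 with hL | hL
  · simp [Set.Ioo_eq_empty_of_le hL]
  · exact (((intervalIntegral.intervalIntegrable_rpow' (a := 0) (b := L)
      (by linarith : -1 < r - 1)).1).mono_set Set.Ioo_subset_Ioc_self).hasFiniteIntegral

lemma lintegral_lintegral_posPowE_lt_top {a b r : ℝ} (hr : 0 < r) {f : ℝ → ℂ} (hf : Integrable f)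
    (hsupp : ∀ t ∉ Set.Ioo a b, f t = 0) :
    ∫⁻ x in Set.Ioo a b, ∫⁻ v, posPowE r (x - v) * ‖f v‖ₑ < ⊤ := by
  have m1 := measurable_posPowE r
  rw [lintegral_lintegral_swap]
  · refine lt_of_le_of_lt (b := ∫⁻ v, (∫⁻ u in Set.Iio (b - a), posPowE r u) * ‖f v‖ₑ) ?_ ?_
    · refine lintegral_mono fun v => ?_
      rw [lintegral_mul_const _ (by fun_prop)]
      by_cases hv : v ∈ Set.Ioo a b
      · refine mul_le_mul' ?_ le_rfl
        rw [← lintegral_indicator measurableSet_Iio, ← lintegral_indicator measurableSet_Ioo,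
          ← lintegral_sub_right_eq_self ((Set.Iio (b - a)).indicator _) v]
        refine lintegral_mono fun x => ?_
        by_cases hx : x ∈ Set.Ioo a b
        · rw [Set.indicator_of_mem hx, Set.indicator_of_mem]
          have := hv.1; have := hx.2
          simp only [Set.mem_Iio]; linarith
        · rw [Set.indicator_of_notMem hx]; simp
      · simp [hsupp v hv]
    · rw [lintegral_const_mul' _ _ (lintegral_posPowE_lt_top hr _).ne]
      exact ENNReal.mul_lt_top (lintegral_posPowE_lt_top hr _) hf.hasFiniteIntegral
  · refine AEMeasurable.mul (Measurable.aemeasurable (by fun_prop)) ?_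
    exact hf.aestronglyMeasurable.comp_snd.enorm

lemma ae_lintegral_posPowE_lt_top {a b r : ℝ} (hr : 0 < r) {f : ℝ → ℂ} (hf : Integrable f)
    (hsupp : ∀ t ∉ Set.Ioo a b, f t = 0) :
    ∀ᵐ x ∂(volume.restrict (Set.Ioo a b)), ∫⁻ v, posPowE r (x - v) * ‖f v‖ₑ < ⊤ := by
  have m1 := measurable_posPowE r
  refine ae_lt_top' (AEMeasurable.lintegral_prod_right' (f := fun p : ℝ × ℝ =>
    posPowE r (p.1 - p.2) * ‖f p.2‖ₑ) ?_) (lintegral_lintegral_posPowE_lt_top hr hf hsupp).ne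
  refine AEMeasurable.mul (Measurable.aemeasurable (by fun_prop)) ?_
  exact hf.aestronglyMeasurable.comp_snd.enorm

/-- Near `x` the boundedness of `f` makes `∫ (x - v) ^ (r - 1) |f(v)| dv` converge; away from `x`
the power is bounded and the integrability of `f` is enough. -/
lemma lintegral_posPowE_lt_top_of_bounded {a b r : ℝ} (hr : 0 < r) {f : ℝ → ℂ} (hf : Integrable f)
    (hsupp : ∀ t ∉ Set.Ioo a b, f t = 0) {x c M : ℝ} (hx : x ≤ b) (hc : c < x)
    (hM : ∀ᵐ t ∂(volume.restrict (Set.Ioo c x)), ‖f t‖ ≤ M) :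
    ∫⁻ v, posPowE r (x - v) * ‖f v‖ₑ < ⊤ := by
  have m1 := measurable_posPowE r
  rw [← lintegral_add_compl _ (measurableSet_Ioo (a := c) (b := x)), ENNReal.add_lt_top]
  constructor
  · refine lt_of_le_of_lt (b := ∫⁻ v in Set.Ioo c x, posPowE r (x - v) * ENNReal.ofReal M) ?_ ?_
    · refine lintegral_mono_ae ?_
      filter_upwards [hM] with t ht
      gcongr
      rw [← ofReal_norm]
      exact ENNReal.ofReal_le_ofReal ht
    · rw [lintegral_mul_const _ (by fun_prop)]
      refine ENNReal.mul_lt_top (lt_of_le_of_lt ?_ (lintegral_posPowE_lt_top hr (x - c))) (by simp)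
      rw [← lintegral_indicator measurableSet_Iio, ← lintegral_indicator measurableSet_Ioo,
        ← lintegral_sub_left_eq_self ((Set.Iio (x - c)).indicator _) x]
      refine lintegral_mono fun t => ?_
      by_cases ht : t ∈ Set.Ioo c x
      · rw [Set.indicator_of_mem ht, Set.indicator_of_mem]
        have := ht.1
        simp only [Set.mem_Iio]; linarith
      · rw [Set.indicator_of_notMem ht]; simp
  · refine lt_of_le_of_lt (b := ∫⁻ v, ENNReal.ofReal ((x - c) ^ (r - 1) + (b - a) ^ (r - 1)) *
      ‖f v‖ₑ) (le_trans (setLIntegral_mono' (g := fun v =>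
        ENNReal.ofReal ((x - c) ^ (r - 1) + (b - a) ^ (r - 1)) * ‖f v‖ₑ)
      measurableSet_Ioo.compl ?_) (setLIntegral_le_lintegral _ _)) ?_
    · intro v hv
      by_cases hv' : v ∈ Set.Ioo a b
      · gcongr
        unfold posPowE
        split_ifs with h
        · apply ENNReal.ofReal_le_ofReal
          have h3 : x - c ≤ x - v := by
            by_contra! h4
            exact hv ⟨by linarith, by linarith⟩
          have h4 : x - v ≤ b - a := by have := hv'.1; linarith
          have p1 : 0 ≤ (x - c) ^ (r - 1) := Real.rpow_nonneg (by linarith) _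
          have p2 : 0 ≤ (b - a) ^ (r - 1) := Real.rpow_nonneg (by linarith) _
          rcases le_total r 1 with hr1 | hr1
          · have := Real.rpow_le_rpow_of_nonpos (by linarith) h3 (by linarith : r - 1 ≤ 0)
            linarith
          · have := Real.rpow_le_rpow h.le h4 (by linarith : 0 ≤ r - 1)
            linarith
        · simp
      · simp [hsupp v hv']
    · rw [lintegral_const_mul' _ _ (by simp)]
      exact ENNReal.mul_lt_top (by simp) hf.hasFiniteIntegral

lemma lintegral_posPowE_lt_top_of_one_le {a b r : ℝ} (hr : 1 ≤ r) {f : ℝ → ℂ} (hf : Integrable f)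
    (hsupp : ∀ t ∉ Set.Ioo a b, f t = 0) {x : ℝ} (hx : x ≤ b) :
    ∫⁻ v, posPowE r (x - v) * ‖f v‖ₑ < ⊤ := by
  refine lt_of_le_of_lt (b := ∫⁻ v, ENNReal.ofReal ((b - a) ^ (r - 1)) * ‖f v‖ₑ) ?_ ?_
  · refine lintegral_mono fun v => ?_
    by_cases hv' : v ∈ Set.Ioo a b
    · gcongr
      unfold posPowE
      split_ifs with h
      · apply ENNReal.ofReal_le_ofReal
        have h4 : x - v ≤ b - a := by have := hv'.1; linarith
        exact Real.rpow_le_rpow h.le h4 (by linarith : 0 ≤ r - 1)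
      · simp
    · simp [hsupp v hv']
  · rw [lintegral_const_mul' _ _ (by simp)]
    exact ENNReal.mul_lt_top (by simp) hf.hasFiniteIntegral

/-! ### Riemann-Liouville integrals and their inversion -/

/-- The Riemann-Liouville kernel `u ^ (κ - 1) / Γ(κ)` on `u > 0`, extended by zero. -/
noncomputable def rlKer (κ : ℂ) (u : ℝ) : ℂ := (Complex.Gamma κ)⁻¹ * posPow κ u

lemma rlKer_of_nonpos (κ : ℂ) {u : ℝ} (hu : u ≤ 0) : rlKer κ u = 0 := by
  simp [rlKer, posPow, hu.not_gt]

lemma powerBound_rlKer (L : ℝ) (κ : ℂ) : PowerBound L κ.re (rlKer κ) :=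
  (powerBound_posPow L κ).const_mul _

lemma volterra_const_mul_left (z : ℂ) (k f : ℝ → ℂ) (x : ℝ) :
    volterra (fun u => z * k u) f x = z * volterra k f x := by
  simp only [volterra, mul_assoc, integral_const_mul]

lemma volterra_const_mul_right (z : ℂ) (k f : ℝ → ℂ) (x : ℝ) :
    volterra k (fun u => z * f u) x = z * volterra k f x := by
  simp only [volterra, mul_left_comm, integral_const_mul]

lemma volterra_rlKer_rlKer {κ τ : ℂ} (hκ : 0 < κ.re) (hτ : 0 < τ.re) :
    volterra (rlKer κ) (rlKer τ) = rlKer (κ + τ) := by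
  ext u
  have h1 := Complex.Gamma_ne_zero_of_re_pos hκ
  have h2 := Complex.Gamma_ne_zero_of_re_pos hτ
  unfold rlKer
  rw [volterra_const_mul_left, volterra_const_mul_right, volterra_posPow,
    Complex.betaIntegral_eq_Gamma_mul_div _ _ hτ hκ, add_comm τ κ]
  field_simp

lemma volterra_congr_ae {a b : ℝ} {k f g : ℝ → ℂ} (hk : ∀ u ≤ 0, k u = 0)
    (hf : ∀ t ≤ a, f t = 0) (hg : ∀ t ≤ a, g t = 0)
    (hfg : ∀ᵐ t ∂(volume.restrict (Set.Ioo a b)), f t = g t) {x : ℝ} (hx : x ≤ b) :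
    volterra k f x = volterra k g x := by
  rw [ae_restrict_iff' measurableSet_Ioo] at hfg
  refine integral_congr_ae ?_
  filter_upwards [hfg] with t ht
  rcases le_or_gt t a with h1 | h1
  · simp [hf t h1, hg t h1]
  rcases le_or_gt x t with h2 | h2
  · simp [hk (x - t) (by linarith)]
  · simp only [ht ⟨h1, by linarith⟩]

lemma volterra_eq_zero_of_le {a : ℝ} {k f : ℝ → ℂ} (hk : ∀ u ≤ 0, k u = 0)
    (hf : ∀ t ≤ a, f t = 0) {x : ℝ} (hx : x ≤ a) : volterra k f x = 0 := by
  rw [volterra]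
  convert integral_zero ℝ ℂ with t
  rcases le_or_gt t a with h1 | h1
  · simp [hf t h1]
  · simp [hk (x - t) (by linarith)]

lemma volterra_one {a : ℝ} {f : ℝ → ℂ} (hf : ∀ t ≤ a, f t = 0) {x : ℝ} (hx : a ≤ x) :
    volterra (rlKer 1) f x = ∫ t in a..x, f t := by
  rw [intervalIntegral.integral_of_le hx, integral_Ioc_eq_integral_Ioo,
    ← integral_indicator measurableSet_Ioo, volterra]
  congr 1; ext t
  by_cases h1 : a < t <;> by_cases h2 : t < x <;> simp [rlKer, posPow, h1, h2, hf, not_lt.1]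

lemma aestronglyMeasurable_volterra {k f : ℝ → ℂ} (hk : Measurable k)
    (hf : AEStronglyMeasurable f) :
    AEStronglyMeasurable (volterra k f) := by
  refine AEStronglyMeasurable.integral_prod_right' (f := fun p : ℝ × ℝ => k (p.1 - p.2) * f p.2) ?_
  exact AEStronglyMeasurable.mul (Measurable.aestronglyMeasurable (by fun_prop)) hf.comp_snd

lemma integrableOn_volterra_rlKer {a b : ℝ} {κ : ℂ} (hκ : 0 < κ.re) {f : ℝ → ℂ} (hf : Integrable f)
    (hsupp : ∀ t ∉ Set.Ioo a b, f t = 0) :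
    IntegrableOn (volterra (rlKer κ) f) (Set.Ioo a b) := by
  refine ⟨(aestronglyMeasurable_volterra (powerBound_rlKer 0 κ).measurable hf.1).restrict, ?_⟩
  refine lt_of_le_of_lt (b := ∫⁻ x in Set.Ioo a b, ‖(Complex.Gamma κ)⁻¹‖ₑ *
    ∫⁻ v, posPowE κ.re (x - v) * ‖f v‖ₑ) (lintegral_mono fun x => ?_) ?_
  · rw [← lintegral_const_mul' _ _ (by simp)]
    refine (enorm_integral_le_lintegral_enorm _).trans (le_of_eq ?_)
    simp only [rlKer, enorm_mul, enorm_posPow, mul_assoc]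
  · rw [lintegral_const_mul' _ _ (by simp)]
    exact ENNReal.mul_lt_top (by simp) (lintegral_lintegral_posPowE_lt_top hκ hf hsupp)

/-- The semigroup law `I^κ I^τ f = I^(κ + τ) f` at a point where the right-hand side converges
absolutely. -/
lemma volterra_rlKer_volterra_rlKer {a b : ℝ} (hab : a < b) {κ τ : ℂ} (hκ : 0 < κ.re)
    (hτ : 0 < τ.re) {f : ℝ → ℂ} (hf : AEStronglyMeasurable f) (hsupp : ∀ t ∉ Set.Ioo a b, f t = 0) {x : ℝ}
    (hx : x ≤ b) (h : ∫⁻ v, posPowE (κ + τ).re (x - v) * ‖f v‖ₑ < ⊤) :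
    volterra (rlKer κ) (volterra (rlKer τ) f) x = volterra (rlKer (κ + τ)) f x := by
  rw [((powerBound_rlKer (b - a) κ).volterra_assoc (powerBound_rlKer (b - a) τ) hκ hτ hab hf hsupp
    hx h).1, volterra_rlKer_rlKer hκ hτ]

lemma integrable_rlKer_mul {κ : ℂ} {f : ℝ → ℂ} (hf : AEStronglyMeasurable f) {x : ℝ}
    (h : ∫⁻ v, posPowE κ.re (x - v) * ‖f v‖ₑ < ⊤) :
    Integrable (fun t => rlKer κ (x - t) * f t) := by
  refine ⟨AEStronglyMeasurable.mul (((powerBound_rlKer 0 κ).measurable.comp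
    (measurable_const.sub measurable_id)).aestronglyMeasurable) hf, ?_⟩
  refine lt_of_eq_of_lt (b := ‖(Complex.Gamma κ)⁻¹‖ₑ * ∫⁻ v, posPowE κ.re (x - v) * ‖f v‖ₑ) ?_
    (ENNReal.mul_lt_top (by simp) h)
  rw [← lintegral_const_mul' _ _ (by simp)]
  simp only [rlKer, enorm_mul, enorm_posPow, mul_assoc]

/-- `I^1` is injective on integrable functions: the primitive of `h` is continuous, so it vanishes
identically, and Lebesgue differentiation gives `h = 0` a.e. -/
lemma ae_eq_zero_of_volterra_one {a b : ℝ} {h : ℝ → ℂ} (hi : Integrable h)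
    (hsupp : ∀ t ≤ a, h t = 0)
    (h0 : ∀ᵐ x ∂(volume.restrict (Set.Ioo a b)), volterra (rlKer 1) h x = 0) :
    ∀ᵐ x ∂(volume.restrict (Set.Ioo a b)), h x = 0 := by
  have hE : Set.EqOn (fun x => ∫ t in a..x, h t) (fun _ => 0) (Set.Ioo a b) := by
    refine Measure.eqOn_open_of_ae_eq (μ := volume) ?_ isOpen_Ioo ?_ continuousOn_const
    · filter_upwards [h0, ae_restrict_mem measurableSet_Ioo] with x hx hx'
      rw [← volterra_one hsupp hx'.1.le]; exact hx
    · exact (intervalIntegral.continuous_primitive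
        (fun _ _ => hi.intervalIntegrable) a).continuousOn
  filter_upwards [ae_restrict_mem measurableSet_Ioo,
    ae_restrict_of_ae (LocallyIntegrable.ae_hasDerivAt_integral hi.locallyIntegrable)] with x hx hx'
  have h1 := hx' a
  have h2 : (fun x => ∫ t in a..x, h t) =ᶠ[𝓝 x] fun _ => 0 :=
    hE.eventuallyEq_of_mem (isOpen_Ioo.mem_nhds hx)
  exact (h1.congr_of_eventuallyEq h2.symm).unique (hasDerivAt_const x 0)

lemma AbsolutelyContinuousOnInterval.clm_comp {f : ℝ → ℂ} {a b : ℝ}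
    (hf : AbsolutelyContinuousOnInterval f a b) (ℓ : ℂ →L[ℝ] ℝ) :
    AbsolutelyContinuousOnInterval (fun x => ℓ (f x)) a b := by
  have h := Tendsto.const_mul ‖ℓ‖ hf
  rw [mul_zero] at h
  refine squeeze_zero (fun E => Finset.sum_nonneg fun _ _ => dist_nonneg) (fun E => ?_) h
  rw [Finset.mul_sum]
  exact Finset.sum_le_sum fun i _ => ℓ.dist_le_opNorm _ _

lemma AbsolutelyContinuousOnInterval.clm_integral_deriv {f : ℝ → ℂ} {a b : ℝ}
    (hf : AbsolutelyContinuousOnInterval f a b) (hi : IntervalIntegrable (deriv f) volume a b)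
    (ℓ : ℂ →L[ℝ] ℝ) : ℓ (∫ x in a..b, deriv f x) = ℓ (f b - f a) := by
  rw [← ℓ.intervalIntegral_comp_comm hi, map_sub, ← (hf.clm_comp ℓ).integral_deriv_eq_sub]
  refine intervalIntegral.integral_congr_ae ?_
  filter_upwards [hf.boundedVariationOn.ae_differentiableAt_of_mem_uIcc] with x hx hx'
  exact (ℓ.hasFDerivAt.comp_hasDerivAt x
    (hx (Set.uIoc_subset_uIcc hx')).hasDerivAt).deriv.symm

/-- The fundamental theorem of calculus for complex-valued absolutely continuous functions, from
the real one applied to the real and imaginary parts. -/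
lemma AbsolutelyContinuousOnInterval.integral_deriv_eq_sub_complex {f : ℝ → ℂ} {a b : ℝ}
    (hf : AbsolutelyContinuousOnInterval f a b) (hi : IntervalIntegrable (deriv f) volume a b) :
    ∫ x in a..b, deriv f x = f b - f a :=
  Complex.ext (hf.clm_integral_deriv hi Complex.reCLM) (hf.clm_integral_deriv hi Complex.imCLM)

/-- The fundamental theorem of calculus on `(a, x)` when absolute continuity holds only on compact
subintervals, the derivative is integrable up to `a` and the value at `a+` is zero. -/
lemma eq_integral_deriv_of_tendsto_zero {a b : ℝ} {G : ℝ → ℂ}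
    (hG : ∀ c d, a < c → c ≤ d → d < b → AbsolutelyContinuousOnInterval G c d)
    (hi : IntegrableOn (deriv G) (Set.Ioo a b)) (h0 : Tendsto G (𝓝[>] a) (𝓝 0)) {x : ℝ}
    (hx : x ∈ Set.Ioo a b) : G x = ∫ t in a..x, deriv G t := by
  have hii : IntervalIntegrable (deriv G) volume a x := by
    rw [intervalIntegrable_iff_integrableOn_Ioc_of_le hx.1.le]
    exact hi.mono_set fun t ht => ⟨ht.1, ht.2.trans_lt hx.2⟩
  have h1 : Tendsto (fun c => ∫ t in c..x, deriv G t) (𝓝[>] a) (𝓝 (G x - 0)) := by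
    refine Tendsto.congr' ?_ (tendsto_const_nhds.sub h0)
    filter_upwards [Ioo_mem_nhdsGT hx.1] with c hc
    refine ((hG c x hc.1 hc.2.le hx.2).integral_deriv_eq_sub_complex ?_).symm
    refine hii.mono_set ?_
    rw [Set.uIcc_of_le hc.2.le, Set.uIcc_of_le hx.1.le]
    exact Set.Icc_subset_Icc_left hc.1.le
  have h2 : Tendsto (fun c => ∫ t in c..x, deriv G t) (𝓝[>] a) (𝓝 (∫ t in a..x, deriv G t)) := by
    have hc := intervalIntegral.continuousWithinAt_primitive (f := deriv G) (μ := volume)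
      (a := x) (b₀ := a) (b₁ := a) (b₂ := x) (by simp) (by
        simpa [hx.1.le] using hii)
    have hc' : Tendsto (fun c => ∫ t in x..c, deriv G t) (𝓝[>] a) (𝓝 (∫ t in x..a, deriv G t)) := by
      refine (hc.tendsto).mono_left ?_
      rw [← nhdsWithin_Ioo_eq_nhdsGT hx.1]
      exact nhdsWithin_mono _ Set.Ioo_subset_Icc_self
    have := hc'.neg
    simp only [← intervalIntegral.integral_symm] at this
    simpa [intervalIntegral.integral_symm x] using this
  have := tendsto_nhds_unique h1 h2
  simpa using this

lemma rlIntegral_eq_volterra {a b : ℝ} (κ : ℂ) (f : ℝ → ℂ) {x : ℝ} (hx : x ∈ Set.Ioc a b) :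
    rlIntegral a κ f x = volterra (rlKer κ) ((Set.Ioo a b).indicator f) x := by
  rw [rlIntegral, intervalIntegral.integral_of_le hx.1.le, integral_Ioc_eq_integral_Ioo,
    ← integral_indicator measurableSet_Ioo, ← integral_const_mul, volterra]
  congr 1; ext t
  by_cases h1 : a < t <;> by_cases h2 : t < x
  · have h3 : t < b := h2.trans_le hx.2
    simp only [Set.indicator, Set.mem_Ioo, h1, h2, h3, and_self, if_true, rlKer, posPow,
      sub_pos]
    rw [show κ - 1 = -(1 - κ) by ring, Complex.cpow_neg]
    ring
  all_goals simp [Set.indicator, h1, h2, rlKer, posPow]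

section Inversion

variable {a b : ℝ} {μ : ℂ} {φ : ℝ → ℂ}

/-- Taylor's formula with zero initial values: the derivative of order `N - (j + 1)` of `g = I^(N
- μ) φ` is `I^(j + 1) D^μ φ` everywhere on `(a, b)`. -/
lemma iteratedDeriv_rlIntegral_eq (hab : a < b) (hφ : IsRLDifferentiable a b μ φ) (j : ℕ)
    (hj : j + 1 ≤ rlOrder μ) {x : ℝ} (hx : x ∈ Set.Ioo a b) :
    iteratedDeriv (rlOrder μ - (j + 1)) (rlIntegral a ((rlOrder μ : ℂ) - μ) φ) x =
      volterra (rlKer ((j : ℂ) + 1)) ((Set.Ioo a b).indicator (rlDeriv a μ φ)) x := by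
  have hDi : Integrable ((Set.Ioo a b).indicator (rlDeriv a μ φ)) :=
    (integrable_indicator_iff measurableSet_Ioo).2 hφ.integrable_deriv
  have hDs : ∀ t ∉ Set.Ioo a b, (Set.Ioo a b).indicator (rlDeriv a μ φ) t = 0 :=
    fun t ht => Set.indicator_of_notMem ht _
  have hDl : ∀ t ≤ a, (Set.Ioo a b).indicator (rlDeriv a μ φ) t = 0 :=
    fun t ht => hDs t fun h => ht.not_gt h.1
  induction j generalizing x with
  | zero =>
    have hd : deriv (iteratedDeriv (rlOrder μ - (0 + 1)) (rlIntegral a ((rlOrder μ : ℂ) - μ) φ)) =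
        rlDeriv a μ φ := by
      rw [← iteratedDeriv_succ, show rlOrder μ - (0 + 1) + 1 = rlOrder μ by omega]; rfl
    rw [eq_integral_deriv_of_tendsto_zero (hφ.absCont _ (by omega))
      (by rw [hd]; exact hφ.integrable_deriv) (hφ.initial _ (by omega)) hx, hd, Nat.cast_zero,
      zero_add, volterra_one hDl hx.1.le]
    refine intervalIntegral.integral_congr_ae (ae_of_all _ fun t ht => ?_)
    rw [Set.uIoc_of_le hx.1.le] at ht
    exact (Set.indicator_of_mem (s := Set.Ioo a b) ⟨ht.1, ht.2.trans_lt hx.2⟩ _).symm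
  | succ j ih =>
    have hd : deriv (iteratedDeriv (rlOrder μ - (j + 1 + 1))
        (rlIntegral a ((rlOrder μ : ℂ) - μ) φ)) =
        iteratedDeriv (rlOrder μ - (j + 1)) (rlIntegral a ((rlOrder μ : ℂ) - μ) φ) := by
      rw [← iteratedDeriv_succ, show rlOrder μ - (j + 1 + 1) + 1 = rlOrder μ - (j + 1) by omega]
    have hre : 0 < ((j : ℂ) + 1).re := by
      simp only [Complex.add_re, Complex.natCast_re, Complex.one_re]; positivity
    have hint : IntegrableOn (iteratedDeriv (rlOrder μ - (j + 1))
        (rlIntegral a ((rlOrder μ : ℂ) - μ) φ)) (Set.Ioo a b) :=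
      (integrableOn_volterra_rlKer hre hDi hDs).congr_fun
        (fun t ht => (ih (by omega) ht).symm) measurableSet_Ioo
    rw [eq_integral_deriv_of_tendsto_zero (hφ.absCont _ (by omega))
      (by rw [hd]; exact hint) (hφ.initial _ (by omega)) hx, hd]
    have h1 : ∫ t in a..x, iteratedDeriv (rlOrder μ - (j + 1))
        (rlIntegral a ((rlOrder μ : ℂ) - μ) φ) t =
        ∫ t in a..x,
          volterra (rlKer ((j : ℂ) + 1)) ((Set.Ioo a b).indicator (rlDeriv a μ φ)) t := by
      refine intervalIntegral.integral_congr_ae (ae_of_all _ fun t ht => ?_)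
      rw [Set.uIoc_of_le hx.1.le] at ht
      exact ih (by omega) ⟨ht.1, ht.2.trans_lt hx.2⟩
    rw [h1, ← volterra_one
      (fun t ht => volterra_eq_zero_of_le (fun u hu => rlKer_of_nonpos _ hu) hDl ht)
      hx.1.le, volterra_rlKer_volterra_rlKer hab (by simp) hre hDi.1 hDs hx.2.le
      (lintegral_posPowE_lt_top_of_one_le ?_ hDi hDs hx.2.le)]
    · congr 2; push_cast; ring
    · simp only [Complex.add_re, Complex.natCast_re, Complex.one_re]
      have : (0 : ℝ) ≤ j := by positivity
      linarith

/-- The inversion formula `I^μ D^μ φ = φ` a.e. on `(a, b)`: both sides have the same image under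
`I^(N - μ)`, namely `I^N D^μ φ`, and `I^(N - μ)` is injective because `I^(2 - (N - μ))` takes it
to `I^2 = I^1 I^1`. -/
lemma ae_eq_volterra_rlDeriv (hab : a < b) (hμ : 0 < μ.re) (hφ : IsRLDifferentiable a b μ φ) :
    ∀ᵐ x ∂(volume.restrict (Set.Ioo a b)),
      φ x = volterra (rlKer μ) ((Set.Ioo a b).indicator (rlDeriv a μ φ)) x := by
  set D := (Set.Ioo a b).indicator (rlDeriv a μ φ) with hD
  set Φ := (Set.Ioo a b).indicator φ with hΦ
  set Ψ := (Set.Ioo a b).indicator (volterra (rlKer μ) D) with hΨ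
  set κ : ℂ := (rlOrder μ : ℂ) - μ with hκdef
  have hN1 : (1 : ℝ) ≤ rlOrder μ := by simp [rlOrder]
  have hκ : 0 < κ.re := by
    have := Nat.lt_floor_add_one μ.re
    simp only [hκdef, rlOrder, Complex.sub_re, Complex.natCast_re]; push_cast; linarith
  have hκ2 : 0 < (2 - κ).re := by
    have := Nat.floor_le hμ.le
    simp only [hκdef, rlOrder, Complex.sub_re, Complex.natCast_re, Complex.re_ofNat]; push_cast
    linarith
  have hDi : Integrable D := (integrable_indicator_iff measurableSet_Ioo).2 hφ.integrable_deriv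
  have hΦi : Integrable Φ := (integrable_indicator_iff measurableSet_Ioo).2 hφ.integrable
  have hDs : ∀ t ∉ Set.Ioo a b, D t = 0 := fun t ht => Set.indicator_of_notMem ht _
  have hΦs : ∀ t ∉ Set.Ioo a b, Φ t = 0 := fun t ht => Set.indicator_of_notMem ht _
  have hΨs : ∀ t ∉ Set.Ioo a b, Ψ t = 0 := fun t ht => Set.indicator_of_notMem ht _
  have hl {f : ℝ → ℂ} (hf : ∀ t ∉ Set.Ioo a b, f t = 0) : ∀ t ≤ a, f t = 0 :=
    fun t ht => hf t fun h => ht.not_gt h.1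
  have hK (τ : ℂ) : ∀ u ≤ 0, rlKer τ u = 0 := fun u hu => rlKer_of_nonpos _ hu
  have hΨi : Integrable Ψ :=
    (integrable_indicator_iff measurableSet_Ioo).2 (integrableOn_volterra_rlKer hμ hDi hDs)
  -- `I^κ φ = I^N D^μ φ = I^κ I^μ D^μ φ` with `κ = N - μ`
  have key : ∀ᵐ x ∂(volume.restrict (Set.Ioo a b)),
      volterra (rlKer κ) (fun t => Φ t - Ψ t) x = 0 := by
    filter_upwards [ae_restrict_mem measurableSet_Ioo,
      ae_lintegral_posPowE_lt_top hκ hΦi hΦs, ae_lintegral_posPowE_lt_top hκ hΨi hΨs]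
      with x hx h1 h2
    have i1 := integrable_rlKer_mul (κ := κ) hΦi.1 h1
    have i2 := integrable_rlKer_mul (κ := κ) hΨi.1 h2
    have e1 : volterra (rlKer κ) Φ x = volterra (rlKer (rlOrder μ : ℂ)) D x := by
      rw [← rlIntegral_eq_volterra κ φ ⟨hx.1, hx.2.le⟩]
      have h := iteratedDeriv_rlIntegral_eq hab hφ (rlOrder μ - 1) (by simp [rlOrder]) hx
      rw [show rlOrder μ - (rlOrder μ - 1 + 1) = 0 by simp [rlOrder]] at h
      rw [iteratedDeriv_zero] at h
      rw [h]; congr 2; simp [rlOrder]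
    have e2 : volterra (rlKer κ) Ψ x = volterra (rlKer (rlOrder μ : ℂ)) D x := by
      rw [volterra_congr_ae (g := volterra (rlKer μ) D) (hK κ) (hl hΨs)
        (fun t ht => volterra_eq_zero_of_le (hK μ) (hl hDs) ht) ?_ hx.2.le,
        volterra_rlKer_volterra_rlKer hab hκ hμ hDi.1 hDs hx.2.le
          (lintegral_posPowE_lt_top_of_one_le (by simpa [hκdef] using hN1) hDi hDs hx.2.le)]
      · simp [hκdef]
      · filter_upwards [ae_restrict_mem measurableSet_Ioo] with t ht
        exact Set.indicator_of_mem ht _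
    have : volterra (rlKer κ) (fun t => Φ t - Ψ t) x =
        volterra (rlKer κ) Φ x - volterra (rlKer κ) Ψ x := by
      simp only [volterra, mul_sub]
      exact integral_sub i1 i2
    rw [this, e1, e2, sub_self]
  have hhi : Integrable (fun t => Φ t - Ψ t) := hΦi.sub hΨi
  have hhs : ∀ t ∉ Set.Ioo a b, Φ t - Ψ t = 0 := fun t ht => by simp [hΦs t ht, hΨs t ht]
  -- `2 - κ` has positive real part, so `I^(2 - κ)` can be applied
  have two : ∀ x ≤ b, volterra (rlKer 2) (fun t => Φ t - Ψ t) x = 0 := by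
    intro x hx
    have h := volterra_rlKer_volterra_rlKer hab hκ2 hκ hhi.1 hhs hx
      (lintegral_posPowE_lt_top_of_one_le (by simp) hhi hhs hx)
    rw [sub_add_cancel] at h
    rw [← h, volterra_congr_ae (g := fun _ => 0) (hK _)
      (fun t ht => volterra_eq_zero_of_le (hK _) (hl hhs) ht) (fun _ _ => rfl) key hx]
    simp [volterra]
  -- `I^1 I^1 (Φ - Ψ) = 0`, and injectivity of `I^1` is used twice
  have one : ∀ᵐ x ∂(volume.restrict (Set.Ioo a b)),
      (Set.Ioo a b).indicator (volterra (rlKer 1) (fun t => Φ t - Ψ t)) x = 0 := by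
    refine ae_eq_zero_of_volterra_one ((integrable_indicator_iff measurableSet_Ioo).2
      (integrableOn_volterra_rlKer (by simp) hhi hhs)) (fun t ht => Set.indicator_of_notMem
        (fun h => ht.not_gt h.1) _) ?_
    filter_upwards [ae_restrict_mem measurableSet_Ioo] with x hx
    rw [volterra_congr_ae (g := volterra (rlKer 1) (fun t => Φ t - Ψ t)) (hK _)
      (fun t ht => Set.indicator_of_notMem (fun h => ht.not_gt h.1) _)
      (fun t ht => volterra_eq_zero_of_le (hK _) (hl hhs) ht) ?_ hx.2.le,
      volterra_rlKer_volterra_rlKer hab (by simp) (by simp) hhi.1 hhs hx.2.le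
        (lintegral_posPowE_lt_top_of_one_le (by simp) hhi hhs hx.2.le), one_add_one_eq_two,
      two x hx.2.le]
    filter_upwards [ae_restrict_mem measurableSet_Ioo] with t ht
    exact Set.indicator_of_mem ht _
  have zero := ae_eq_zero_of_volterra_one (b := b) hhi (hl hhs) (by
    filter_upwards [ae_restrict_mem measurableSet_Ioo, one] with x hx hx1
    rwa [Set.indicator_of_mem hx] at hx1)
  filter_upwards [ae_restrict_mem measurableSet_Ioo, zero] with x hx hx0
  rw [hΦ, hΨ, Set.indicator_of_mem hx, Set.indicator_of_mem hx] at hx0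
  exact sub_eq_zero.1 hx0

end Inversion

/-! ### Loop integrals and Cauchy's theorem -/

/-- A unit-speed parametrization by `ℝ` of the loop that comes from `+∞ - iT`, runs from `c - iT`
to `c + iT` for `|y| ≤ T`, and returns to `+∞ + iT`. -/
noncomputable def loopPath (c T y : ℝ) : ℂ :=
  ((c + max 0 (|y| - T) : ℝ) : ℂ) + ((max (-T) (min T y) : ℝ) : ℂ) * Complex.I

/-- The derivative of `loopPath c T` (off the two corners). -/
noncomputable def loopSpeed (T y : ℝ) : ℂ := if y < -T then -1 else if y ≤ T then Complex.I else 1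

lemma loopPath_re (c T y : ℝ) : (loopPath c T y).re = c + max 0 (|y| - T) := by simp [loopPath]

lemma loopPath_im (c T y : ℝ) : (loopPath c T y).im = max (-T) (min T y) := by simp [loopPath]

lemma continuous_loopPath (c T : ℝ) : Continuous (loopPath c T) := by
  unfold loopPath; fun_prop

lemma measurable_loopSpeed (T : ℝ) : Measurable (loopSpeed T) := by
  unfold loopSpeed
  exact Measurable.ite measurableSet_Iio measurable_const
    (Measurable.ite measurableSet_Iic measurable_const measurable_const)

lemma norm_loopSpeed (T y : ℝ) : ‖loopSpeed T y‖ = 1 := by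
  unfold loopSpeed; split_ifs <;> simp

lemma le_loopPath_re (c T y : ℝ) : c ≤ (loopPath c T y).re := by
  rw [loopPath_re]; linarith [le_max_left 0 (|y| - T)]

lemma loopPath_mem {T : ℝ} (hT : 0 < T) (c y : ℝ) :
    (loopPath c T y).re = c ∨ |(loopPath c T y).im| = T := by
  rw [loopPath_re, loopPath_im]
  rcases le_or_gt (|y|) T with h | h
  · left; rw [max_eq_left (by linarith), add_zero]
  · right
    rcases lt_abs.1 h with h | h
    · rw [min_eq_left h.le, max_eq_right (by linarith), abs_of_pos hT]
    · rw [max_eq_left ((min_le_right _ _).trans (by linarith)), abs_neg, abs_of_pos hT]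

lemma loopIntegral_eq_integral {c T : ℝ} (hT : 0 < T) {F : ℂ → ℂ}
    (hF : Integrable (fun y => F (loopPath c T y) * loopSpeed T y)) :
    loopIntegral c T F =
      1 / (2 * Real.pi * Complex.I) * ∫ y, F (loopPath c T y) * loopSpeed T y := by
  have h1 : ∫ y in Set.Iio (-T), F (loopPath c T y) * loopSpeed T y =
      -∫ s in Set.Ioi c, F ((s : ℂ) - T * Complex.I) := by
    rw [← integral_neg, ← integral_Iic_eq_integral_Iio]
    have e : Set.EqOn (fun y => F (loopPath c T y) * loopSpeed T y)
        (fun y => (fun s : ℝ => -F ((s : ℂ) - T * Complex.I)) (-y - (T - c))) (Set.Iio (-T)) := by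
      intro y hy
      have hy' : y < -T := hy
      have h3 : |y| = -y := abs_of_neg (by linarith)
      simp only [loopSpeed, if_pos hy', loopPath, h3]
      rw [max_eq_right (by linarith), min_eq_right (by linarith), max_eq_left (by linarith)]
      rw [mul_neg_one]; congr 2; push_cast; ring
    rw [integral_Iic_eq_integral_Iio, setIntegral_congr_fun measurableSet_Iio e,
      ← integral_Iic_eq_integral_Iio]
    have := integral_comp_neg_Iic (-T) (fun y => (fun s : ℝ => -F ((s : ℂ) - T * Complex.I))
      (y - (T - c)))
    simp only at this ⊢
    rw [this, neg_neg, ← integral_indicator measurableSet_Ioi,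
      ← integral_indicator measurableSet_Ioi,
      ← integral_sub_right_eq_self ((Set.Ioi c).indicator _) (T - c)]
    congr 1; ext y
    simp only [Set.indicator, Set.mem_Ioi]
    congr 1
    exact propext ⟨fun h => by linarith, fun h => by linarith⟩
  have h2 : ∫ y in Set.Icc (-T) T, F (loopPath c T y) * loopSpeed T y =
      Complex.I * ∫ y in (-T)..T, F ((c : ℂ) + y * Complex.I) := by
    rw [integral_Icc_eq_integral_Ioc, ← intervalIntegral.integral_of_le (by linarith),
      ← intervalIntegral.integral_const_mul]
    refine intervalIntegral.integral_congr fun y hy => ?_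
    rw [Set.uIcc_of_le (by linarith)] at hy
    have h3 : |y| ≤ T := abs_le.2 hy
    simp only [loopSpeed, if_neg hy.1.not_gt, if_pos hy.2, loopPath]
    rw [max_eq_left (by linarith), min_eq_right hy.2, max_eq_right hy.1, add_zero]
    ring
  have h3 : ∫ y in Set.Ioi T, F (loopPath c T y) * loopSpeed T y =
      ∫ s in Set.Ioi c, F ((s : ℂ) + T * Complex.I) := by
    have e : Set.EqOn (fun y => F (loopPath c T y) * loopSpeed T y)
        (fun y => (fun s : ℝ => F ((s : ℂ) + T * Complex.I)) (y - (T - c))) (Set.Ioi T) := by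
      intro y hy
      have hy' : T < y := hy
      have h3 : |y| = y := abs_of_pos (by linarith)
      simp only [loopSpeed, if_neg hy'.not_ge, if_neg (show ¬ y < -T by linarith), loopPath, h3]
      rw [max_eq_right (by linarith), min_eq_left (by linarith), max_eq_right (by linarith)]
      rw [mul_one]; congr 2; push_cast; ring
    rw [setIntegral_congr_fun measurableSet_Ioi e, ← integral_indicator measurableSet_Ioi,
      ← integral_indicator measurableSet_Ioi,
      ← integral_sub_right_eq_self ((Set.Ioi c).indicator _) (T - c)]
    congr 1; ext y
    simp only [Set.indicator, Set.mem_Ioi]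
    congr 1
    exact propext ⟨fun h => by linarith, fun h => by linarith⟩
  rw [loopIntegral, ← h1, ← h2, ← h3, ← integral_add_compl measurableSet_Iio hF (s := Set.Iio (-T)),
    Set.compl_Iio, ← Set.Icc_union_Ioi_eq_Ici (show -T ≤ T by linarith),
    setIntegral_union (Set.disjoint_left.2 fun x hx hx' => hx.2.not_gt hx') measurableSet_Ioi
      hF.integrableOn hF.integrableOn, add_assoc]

lemma integrable_exp_neg_abs : Integrable (fun y : ℝ => Real.exp (-|y|)) := by
  rw [← integrableOn_univ, ← Set.Iic_union_Ioi (a := (0 : ℝ)), integrableOn_union]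
  constructor
  · refine (integrableOn_exp_Iic 0).congr_fun (fun y hy => ?_) measurableSet_Iic
    simp only [abs_of_nonpos (show y ≤ 0 from hy), neg_neg]
  · refine (integrableOn_exp_neg_Ioi 0).congr_fun (fun y hy => ?_) measurableSet_Ioi
    simp only [abs_of_pos (show 0 < y from hy)]

lemma integrable_loop {c T C : ℝ} (hT : 0 < T) {F : ℂ → ℂ}
    (hF : ∀ y, ContinuousAt F (loopPath c T y))
    (hC : ∀ ξ : ℂ, c ≤ ξ.re → |ξ.im| = T → ‖F ξ‖ ≤ C * Real.exp (-ξ.re)) :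
    Integrable (fun y => F (loopPath c T y) * loopSpeed T y) := by
  have hcont : Continuous (fun y => F (loopPath c T y)) :=
    continuous_iff_continuousAt.2 fun y =>
      (hF y).comp (continuous_loopPath c T).continuousAt
  obtain ⟨M, hM⟩ := (isCompact_Icc (a := -T) (b := T)).exists_bound_of_continuousOn
    hcont.continuousOn
  have hM0 : 0 ≤ M := (norm_nonneg _).trans (hM 0 ⟨by linarith, hT.le⟩)
  refine Integrable.mono' (integrable_exp_neg_abs.const_mul
    (M * Real.exp T + |C| * Real.exp (T - c)))
    (hcont.measurable.mul (measurable_loopSpeed T)).aestronglyMeasurable (ae_of_all _ fun y => ?_)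
  rw [norm_mul, norm_loopSpeed, mul_one]
  rcases le_or_gt (|y|) T with h | h
  · calc _ ≤ M := hM y (abs_le.1 h)
      _ = M * Real.exp T * Real.exp (-T) := by rw [mul_assoc, ← Real.exp_add]; simp
      _ ≤ (M * Real.exp T + |C| * Real.exp (T - c)) * Real.exp (-|y|) := by
        gcongr
        have : 0 ≤ |C| * Real.exp (T - c) := by positivity
        linarith
  · have h1 : |(loopPath c T y).im| = T := (loopPath_mem hT c y).resolve_left (by
      rw [loopPath_re, max_eq_right (by linarith)]
      exact fun h' => by linarith)
    refine (hC _ (le_loopPath_re c T y) h1).trans ?_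
    rw [loopPath_re, max_eq_right (by linarith)]
    calc C * Real.exp (-(c + (|y| - T))) ≤ |C| * Real.exp (-(c + (|y| - T))) := by
          gcongr; exact le_abs_self C
      _ = |C| * Real.exp (T - c) * Real.exp (-|y|) := by
          rw [mul_assoc, ← Real.exp_add]; congr 2; ring
      _ ≤ _ := by
          gcongr
          have : 0 ≤ M * Real.exp T := by positivity
          linarith

lemma integrableOn_Ioi_line {c t C : ℝ} {F : ℂ → ℂ}
    (hF : ∀ ξ : ℂ, c ≤ ξ.re → ξ.im = t → ContinuousAt F ξ)
    (hC : ∀ ξ : ℂ, c ≤ ξ.re → ξ.im = t → ‖F ξ‖ ≤ C * Real.exp (-ξ.re)) :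
    IntegrableOn (fun s : ℝ => F (s + t * Complex.I)) (Set.Ioi c) := by
  refine Integrable.mono' ((integrableOn_exp_neg_Ioi c).const_mul C) ?_ ?_
  · refine ContinuousOn.aestronglyMeasurable (fun s hs => ContinuousAt.continuousWithinAt ?_)
      measurableSet_Ioi
    refine ContinuousAt.comp (g := F) (hF _ ?_ ?_) (by fun_prop)
    · simpa using (le_of_lt hs)
    · simp
  · filter_upwards [ae_restrict_mem measurableSet_Ioi] with s hs
    have := hC (s + t * Complex.I) (by simpa using (le_of_lt hs)) (by simp)
    simpa using this

/-- Cauchy's theorem for the half-strip `Re ξ ≥ c`, `y₁ ≤ Im ξ ≤ y₂`, as a limit of rectangles. -/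
lemma integral_Ioi_sub_integral_Ioi {c y₁ y₂ C : ℝ} (hy : y₁ ≤ y₂) {F : ℂ → ℂ}
    (hF : ∀ ξ : ℂ, c ≤ ξ.re → ξ.im ∈ Set.Icc y₁ y₂ → DifferentiableAt ℂ F ξ)
    (hC : ∀ ξ : ℂ, c ≤ ξ.re → ξ.im ∈ Set.Icc y₁ y₂ → ‖F ξ‖ ≤ C * Real.exp (-ξ.re)) :
    (∫ s : ℝ in Set.Ioi c, F (s + y₁ * Complex.I)) -
      (∫ s : ℝ in Set.Ioi c, F (s + y₂ * Complex.I)) =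
      Complex.I * ∫ y in y₁..y₂, F (c + y * Complex.I) := by
  have lim (t : ℝ) (ht : t ∈ Set.Icc y₁ y₂) :
      Tendsto (fun X : ℝ => ∫ s : ℝ in c..X, F (s + t * Complex.I)) atTop
        (𝓝 (∫ s : ℝ in Set.Ioi c, F (s + t * Complex.I))) :=
    intervalIntegral_tendsto_integral_Ioi c (integrableOn_Ioi_line (C := C)
      (fun ξ h1 h2 => (hF ξ h1 (h2 ▸ ht)).continuousAt) (fun ξ h1 h2 => hC ξ h1 (h2 ▸ ht)))
      tendsto_id
  have lim0 : Tendsto (fun X : ℝ => Complex.I * ∫ y in y₁..y₂, F (X + y * Complex.I)) atTop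
      (𝓝 0) := by
    have e : Tendsto (fun X : ℝ => C * Real.exp (-X) * |y₂ - y₁|) atTop (𝓝 0) := by
      have := (Real.tendsto_exp_neg_atTop_nhds_zero.const_mul C).mul_const (|y₂ - y₁|)
      simpa using this
    refine squeeze_zero_norm' ?_ e
    filter_upwards [eventually_ge_atTop c] with X hX
    rw [norm_mul, Complex.norm_I, one_mul]
    refine intervalIntegral.norm_integral_le_of_norm_le_const fun y hy' => ?_
    rw [Set.uIoc_of_le hy] at hy'
    have := hC (X + y * Complex.I) (by simpa using hX) (by simpa using ⟨hy'.1.le, hy'.2⟩)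
    simpa using this
  have key : ∀ᶠ X : ℝ in atTop, (∫ s : ℝ in c..X, F (s + y₁ * Complex.I)) -
      (∫ s : ℝ in c..X, F (s + y₂ * Complex.I)) +
      Complex.I * (∫ y in y₁..y₂, F (X + y * Complex.I)) =
      Complex.I * ∫ y in y₁..y₂, F (c + y * Complex.I) := by
    filter_upwards [eventually_ge_atTop c] with X hX
    have := Complex.integral_boundary_rect_eq_zero_of_differentiableOn F ⟨c, y₁⟩ ⟨X, y₂⟩ (by
      intro ξ hξ
      rw [Complex.mem_reProdIm, Set.uIcc_of_le hX, Set.uIcc_of_le hy] at hξ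
      exact (hF ξ hξ.1.1 hξ.2).differentiableWithinAt)
    simp only [smul_eq_mul] at this
    exact sub_eq_zero.1 this
  have l := ((lim y₁ ⟨le_rfl, hy⟩).sub (lim y₂ ⟨hy, le_rfl⟩)).add lim0
  rw [add_zero] at l
  exact tendsto_nhds_unique l (tendsto_const_nhds.congr' (key.mono fun _ h => h.symm))

lemma loopIntegral_eq_of_le_left {c₁ c₂ T C : ℝ} (hc : c₁ ≤ c₂) (hT : 0 < T) {F : ℂ → ℂ}
    (hF : ∀ ξ : ℂ, c₁ ≤ ξ.re → (ξ.re ≤ c₂ ∧ |ξ.im| ≤ T ∨ |ξ.im| = T) → DifferentiableAt ℂ F ξ)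
    (hC : ∀ ξ : ℂ, c₁ ≤ ξ.re → |ξ.im| = T → ‖F ξ‖ ≤ C * Real.exp (-ξ.re)) :
    loopIntegral c₁ T F = loopIntegral c₂ T F := by
  have hi (t : ℝ) (ht : |t| = T) : IntegrableOn (fun s : ℝ => F (s + t * Complex.I)) (Set.Ioi c₁) :=
    integrableOn_Ioi_line (C := C) (fun ξ h1 h2 => (hF ξ h1 (Or.inr (h2 ▸ ht))).continuousAt)
      (fun ξ h1 h2 => hC ξ h1 (h2 ▸ ht))
  have split (t : ℝ) (ht : |t| = T) : ∫ s : ℝ in Set.Ioi c₁, F (s + t * Complex.I) =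
      (∫ s : ℝ in c₁..c₂, F (s + t * Complex.I)) +
        ∫ s : ℝ in Set.Ioi c₂, F (s + t * Complex.I) := by
    rw [intervalIntegral.integral_of_le hc, ← setIntegral_union (Set.Ioc_disjoint_Ioi le_rfl)
      measurableSet_Ioi ((hi t ht).mono_set Set.Ioc_subset_Ioi_self)
      ((hi t ht).mono_set (Set.Ioi_subset_Ioi hc)), Set.Ioc_union_Ioi_eq_Ioi hc]
  have rect := Complex.integral_boundary_rect_eq_zero_of_differentiableOn F ⟨c₁, -T⟩ ⟨c₂, T⟩ (by
      intro ξ hξ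
      rw [Complex.mem_reProdIm, Set.uIcc_of_le hc, Set.uIcc_of_le (by simp; linarith)] at hξ
      exact (hF ξ hξ.1.1 (Or.inl ⟨hξ.1.2, abs_le.2 hξ.2⟩)).differentiableWithinAt)
  have s1 := split (-T) (by rw [abs_neg, abs_of_pos hT])
  have s2 := split T (abs_of_pos hT)
  simp only [Complex.ofReal_neg, neg_mul, ← sub_eq_add_neg, smul_eq_mul] at rect s1
  unfold loopIntegral
  rw [s1, s2]
  congr 1
  linear_combination -rect

lemma loopIntegral_eq_of_le_height {c T₁ T₂ C : ℝ} (hT : T₁ ≤ T₂) (hT₁ : 0 < T₁) {F : ℂ → ℂ}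
    (hF : ∀ ξ : ℂ, c ≤ ξ.re → T₁ ≤ |ξ.im| → |ξ.im| ≤ T₂ → DifferentiableAt ℂ F ξ)
    (hF' : ∀ ξ : ℂ, ξ.re = c → DifferentiableAt ℂ F ξ)
    (hC : ∀ ξ : ℂ, c ≤ ξ.re → T₁ ≤ |ξ.im| → |ξ.im| ≤ T₂ → ‖F ξ‖ ≤ C * Real.exp (-ξ.re)) :
    loopIntegral c T₁ F = loopIntegral c T₂ F := by
  have mem1 {t : ℝ} (ht : t ∈ Set.Icc T₁ T₂) : T₁ ≤ |t| ∧ |t| ≤ T₂ := by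
    rw [abs_of_pos (hT₁.trans_le ht.1)]; exact ht
  have mem2 {t : ℝ} (ht : t ∈ Set.Icc (-T₂) (-T₁)) : T₁ ≤ |t| ∧ |t| ≤ T₂ := by
    rw [abs_of_neg (by linarith [ht.2])]; exact ⟨by linarith [ht.2], by linarith [ht.1]⟩
  have u := integral_Ioi_sub_integral_Ioi (c := c) hT (F := F)
    (fun ξ h1 h2 => hF ξ h1 (mem1 h2).1 (mem1 h2).2)
    (fun ξ h1 h2 => hC ξ h1 (mem1 h2).1 (mem1 h2).2)
  have d := integral_Ioi_sub_integral_Ioi (c := c) (neg_le_neg hT) (F := F)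
    (fun ξ h1 h2 => hF ξ h1 (mem2 h2).1 (mem2 h2).2)
    (fun ξ h1 h2 => hC ξ h1 (mem2 h2).1 (mem2 h2).2)
  have hi (x y : ℝ) : IntervalIntegrable (fun y : ℝ => F (c + y * Complex.I)) volume x y := by
    refine Continuous.intervalIntegrable (continuous_iff_continuousAt.2 fun y => ?_) _ _
    exact ContinuousAt.comp (g := F) (hF' _ (by simp)).continuousAt (by fun_prop)
  have a1 := intervalIntegral.integral_add_adjacent_intervals (hi (-T₂) (-T₁)) (hi (-T₁) T₁)
  have a2 := intervalIntegral.integral_add_adjacent_intervals (hi (-T₂) T₁) (hi T₁ T₂)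
  simp only [Complex.ofReal_neg, neg_mul, ← sub_eq_add_neg] at d
  unfold loopIntegral
  congr 1
  linear_combination u + d + Complex.I * a1 + Complex.I * a2

/-- The loop integral does not depend on the loop: both loops are compared with the one through
`min c₁ c₂` of height `max T₁ T₂`, first lowering the height and then moving the vertical side. -/
lemma loopIntegral_congr {c₁ c₂ T₁ T₂ C : ℝ} (hT₁ : 0 < T₁) (hT₂ : 0 < T₂) {F : ℂ → ℂ}
    (hF : ∀ ξ : ℂ, min c₁ c₂ ≤ ξ.re → (ξ.re ≤ max c₁ c₂ ∨ min T₁ T₂ ≤ |ξ.im|) →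
      DifferentiableAt ℂ F ξ)
    (hC : ∀ ξ : ℂ, min c₁ c₂ ≤ ξ.re → min T₁ T₂ ≤ |ξ.im| → |ξ.im| ≤ max T₁ T₂ →
      ‖F ξ‖ ≤ C * Real.exp (-ξ.re)) :
    loopIntegral c₁ T₁ F = loopIntegral c₂ T₂ F := by
  have main (c T : ℝ) (hT : 0 < T) (h1 : min c₁ c₂ ≤ c) (h2 : c ≤ max c₁ c₂)
      (h3 : min T₁ T₂ ≤ T) (h4 : T ≤ max T₁ T₂) :
      loopIntegral (min c₁ c₂) (max T₁ T₂) F = loopIntegral c T F := by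
    rw [← loopIntegral_eq_of_le_height (C := C) h4 hT
      (fun ξ a1 a2 a3 => hF ξ a1 (Or.inr (h3.trans a2)))
      (fun ξ a1 => hF ξ a1.ge (Or.inl (a1 ▸ min_le_max)))
      (fun ξ a1 a2 a3 => hC ξ a1 (h3.trans a2) a3)]
    refine loopIntegral_eq_of_le_left (C := C) h1 hT (fun ξ a1 a2 => hF ξ a1 ?_)
      (fun ξ a1 a2 => hC ξ a1 (a2 ▸ h3) (a2 ▸ h4))
    rcases a2 with a2 | a2
    · exact Or.inl (a2.1.trans h2)
    · exact Or.inr (a2 ▸ h3)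
  rw [← main c₁ T₁ hT₁ (min_le_left _ _) (le_max_left _ _) (min_le_left _ _) (le_max_left _ _),
    ← main c₂ T₂ hT₂ (min_le_right _ _) (le_max_right _ _) (min_le_right _ _) (le_max_right _ _)]

/-! ### Estimates for the Gamma function on horizontal strips -/

lemma isCompact_strip (x y T : ℝ) : IsCompact {z : ℂ | x ≤ z.re ∧ z.re ≤ y ∧ |z.im| ≤ T} := by
  have : {z : ℂ | x ≤ z.re ∧ z.re ≤ y ∧ |z.im| ≤ T} = Set.Icc x y ×ℂ Set.Icc (-T) T := by
    ext z
    simp only [Set.mem_ofPred_eq, Complex.mem_reProdIm, Set.mem_Icc, abs_le, and_assoc]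
  rw [this]
  exact isCompact_Icc.reProdIm isCompact_Icc

lemma exists_le_norm_Gamma (T : ℝ) : ∃ m > 0, ∀ (n : ℕ) (z : ℂ), 1 ≤ z.re → z.re ≤ 2 →
    |z.im| ≤ T → m * n.factorial ≤ ‖Complex.Gamma (z + n)‖ := by
  have hne (z : ℂ) (h : 1 ≤ z.re) : Complex.Gamma z ≠ 0 :=
    Complex.Gamma_ne_zero_of_re_pos (by linarith)
  obtain ⟨M, hM⟩ := (isCompact_strip 1 2 T).exists_bound_of_continuousOn
    (f := fun z => (Complex.Gamma z)⁻¹)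
    Complex.differentiable_one_div_Gamma.continuous.continuousOn
  refine ⟨(|M| + 1)⁻¹, by positivity, fun n z h1 h2 h3 => ?_⟩
  induction n with
  | zero =>
    have h := hM z ⟨h1, h2, h3⟩
    rw [norm_inv] at h
    have h4 : 0 < ‖Complex.Gamma z‖ := norm_pos_iff.2 (hne z h1)
    simp only [Nat.factorial_zero, Nat.cast_one, mul_one, Nat.cast_zero, add_zero]
    rw [inv_le_comm₀ (by positivity) h4]
    linarith [le_abs_self M]
  | succ n ih =>
    have hre : ((n : ℝ) + 1) ≤ (z + n).re := by simp; linarith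
    have h0 : z + n ≠ 0 := fun h => by rw [h] at hre; simp at hre; linarith [n.cast_nonneg (α := ℝ)]
    rw [Nat.cast_succ, ← add_assoc, Complex.Gamma_add_one _ h0, norm_mul, Nat.factorial_succ]
    push_cast
    calc _ = ((n : ℝ) + 1) * ((|M| + 1)⁻¹ * n.factorial) := by ring
      _ ≤ _ := mul_le_mul (hre.trans (Complex.re_le_norm _)) ih (by positivity) (norm_nonneg _)

/-- On a horizontal strip `1 / Γ` decays faster than any exponential as `Re z → ∞`. -/
lemma exists_norm_inv_Gamma_le (x T : ℝ) {K : ℝ} (hK : 0 ≤ K) : ∃ C, ∀ z : ℂ, x ≤ z.re →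
    |z.im| ≤ T → ‖(Complex.Gamma z)⁻¹‖ ≤ C * Real.exp (-(K * z.re)) := by
  obtain ⟨M, hM⟩ := (isCompact_strip x 1 T).exists_bound_of_continuousOn
    (f := fun z => (Complex.Gamma z)⁻¹)
    Complex.differentiable_one_div_Gamma.continuous.continuousOn
  obtain ⟨m, hm, hG⟩ := exists_le_norm_Gamma T
  refine ⟨|M| * Real.exp K + m⁻¹ * Real.exp (2 * K) * Real.exp (Real.exp K), fun z h1 h2 => ?_⟩
  rcases le_or_gt z.re 1 with h | h
  · calc _ ≤ |M| := (hM z ⟨h1, h, h2⟩).trans (le_abs_self M)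
      _ = |M| * Real.exp K * Real.exp (-K) := by rw [mul_assoc, ← Real.exp_add]; simp
      _ ≤ (|M| * Real.exp K + m⁻¹ * Real.exp (2 * K) * Real.exp (Real.exp K)) *
          Real.exp (-(K * z.re)) := by
        refine mul_le_mul ?_ (Real.exp_le_exp.2 ?_) (by positivity) (by positivity)
        · have : 0 ≤ m⁻¹ * Real.exp (2 * K) * Real.exp (Real.exp K) := by positivity
          linarith
        · nlinarith
  · -- `z = (z - n) + n` with `1 ≤ Re (z - n) < 2`
    set n := ⌊z.re - 1⌋₊ with hn
    have n1 : (n : ℝ) ≤ z.re - 1 := Nat.floor_le (by linarith)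
    have n2 : z.re - 1 < n + 1 := Nat.lt_floor_add_one _
    have h3 := hG n (z - n) (by simp; linarith) (by simp; linarith) (by simpa using h2)
    rw [sub_add_cancel] at h3
    have hf : (0 : ℝ) < n.factorial := by positivity
    have h4 : Real.exp (K * z.re) ≤ Real.exp (2 * K) * (Real.exp (Real.exp K) * n.factorial) := by
      calc Real.exp (K * z.re) ≤ Real.exp (2 * K + n * K) := Real.exp_le_exp.2 (by nlinarith)
        _ = Real.exp (2 * K) * Real.exp K ^ n := by rw [Real.exp_add, Real.exp_nat_mul]
        _ ≤ _ := by
          gcongr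
          have := Real.pow_div_factorial_le_exp (Real.exp K) (Real.exp_pos K).le n
          rwa [div_le_iff₀ hf] at this
    rw [norm_inv]
    calc ‖Complex.Gamma z‖⁻¹ ≤ (m * n.factorial)⁻¹ := inv_anti₀ (by positivity) h3
      _ ≤ (m⁻¹ * Real.exp (2 * K) * Real.exp (Real.exp K)) * Real.exp (-(K * z.re)) := by
        rw [Real.exp_neg, inv_le_iff_one_le_mul₀ (by positivity)]
        have he := Real.exp_pos (K * z.re)
        rw [show m⁻¹ * Real.exp (2 * K) * Real.exp (Real.exp K) * (Real.exp (K * z.re))⁻¹ *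
          (m * n.factorial) = (Real.exp (2 * K) * (Real.exp (Real.exp K) * n.factorial)) /
            Real.exp (K * z.re) by field_simp, one_le_div he]
        exact h4
      _ ≤ _ := by
        gcongr
        have : 0 ≤ |M| * Real.exp K := by positivity
        linarith

/-- `Γ(z) / Γ(z + δ) = B(z, δ) / Γ(δ)` is bounded on `Re z ≥ ε`, as `|B(z, δ)| ≤ B(ε, Re δ)`. -/
lemma exists_norm_Gamma_mul_inv_Gamma_le {δ : ℂ} (hδ : 0 < δ.re) {ε : ℝ} (hε : 0 < ε) :
    ∃ C, ∀ z : ℂ, ε ≤ z.re → ‖Complex.Gamma z * (Complex.Gamma (z + δ))⁻¹‖ ≤ C := by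
  refine ⟨‖(Complex.Gamma δ)⁻¹‖ * ∫ x in Set.Ioo (0 : ℝ) 1,
    ‖(x : ℂ) ^ ((ε : ℂ) - 1) * (1 - (x : ℂ)) ^ (δ - 1)‖, fun z hz => ?_⟩
  have hδ0 := Complex.Gamma_ne_zero_of_re_pos hδ
  have h1 : Complex.Gamma z * (Complex.Gamma (z + δ))⁻¹ =
      (Complex.Gamma δ)⁻¹ * Complex.betaIntegral z δ := by
    rw [Complex.betaIntegral_eq_Gamma_mul_div _ _ (by linarith) hδ]
    field_simp
  rw [h1, norm_mul, Complex.betaIntegral, intervalIntegral.integral_of_le zero_le_one,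
    integral_Ioc_eq_integral_Ioo]
  gcongr
  refine norm_integral_le_of_norm_le ?_ ?_
  · have := (Complex.betaIntegral_convergent (u := ε) (v := δ) (by simpa) hδ)
    rw [intervalIntegrable_iff_integrableOn_Ioo_of_le zero_le_one] at this
    exact this.norm
  · filter_upwards [ae_restrict_mem measurableSet_Ioo] with x hx
    rw [norm_mul, norm_mul, Complex.norm_cpow_eq_rpow_re_of_pos hx.1,
      Complex.norm_cpow_eq_rpow_re_of_pos hx.1]
    gcongr ?_ * _
    refine Real.rpow_le_rpow_of_exponent_ge hx.1 hx.2.le ?_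
    simpa using hz

/-- `Γ(z + μ) / Γ(z)` grows at most exponentially on a strip. The true growth is `|z| ^ Re μ`, but
any exponential is absorbed by the decay of `1 / Γ`. -/
lemma exists_norm_Gamma_add_mul_inv_Gamma_le (n : ℕ) (μ : ℂ) (hμ : μ.re < n) {ε : ℝ}
    (hε : 0 < ε) (T : ℝ) : ∃ C, ∀ z : ℂ, ε ≤ z.re → ε ≤ (z + μ).re → |z.im| ≤ T →
      ‖Complex.Gamma (z + μ) * (Complex.Gamma z)⁻¹‖ ≤ C * Real.exp (n * z.re) := by
  induction n generalizing μ with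
  | zero =>
    obtain ⟨C, hC⟩ := exists_norm_Gamma_mul_inv_Gamma_le (δ := -μ) (by simpa using hμ) hε
    refine ⟨C, fun z _ hz _ => ?_⟩
    have := hC (z + μ) hz
    simpa using this
  | succ n ih =>
    obtain ⟨C, hC⟩ := ih (μ - 1) (by simpa [sub_lt_iff_lt_add] using hμ)
    refine ⟨(1 + |T|) * (|C| * Real.exp n), fun z h1 h2 h3 => ?_⟩
    have h := hC (z + 1) (by simp; linarith) (by simpa using h2) (by simpa using h3)
    rw [show z + 1 + (μ - 1) = z + μ by ring] at h
    rw [Complex.one_div_Gamma_eq_self_mul_one_div_Gamma_add_one, mul_left_comm, norm_mul]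
    have hz : ‖z‖ ≤ (1 + |T|) * Real.exp z.re := by
      calc ‖z‖ ≤ |z.re| + |z.im| := Complex.norm_le_abs_re_add_abs_im z
        _ ≤ Real.exp z.re + |T| * Real.exp z.re := by
          rw [abs_of_pos (by linarith)]
          have e1 := Real.add_one_le_exp z.re
          have e2 : |z.im| ≤ |T| := h3.trans (le_abs_self T)
          have e3 : |T| ≤ |T| * Real.exp z.re :=
            le_mul_of_one_le_right (abs_nonneg T) (by linarith)
          linarith
        _ = _ := by ring
    calc _ ≤ ((1 + |T|) * Real.exp z.re) * (|C| * Real.exp (n * (z + 1).re)) := by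
          refine mul_le_mul hz (h.trans ?_) (norm_nonneg _) (by positivity)
          gcongr; exact le_abs_self C
      _ = _ := by
          simp only [Complex.add_re, Complex.one_re, mul_add, mul_one, Nat.cast_succ, add_mul,
            one_mul, Real.exp_add]
          ring

lemma norm_exp_mul_I (z : ℂ) : ‖Complex.exp (z * Complex.I)‖ = Real.exp (-z.im) := by
  rw [Complex.norm_exp]; simp

lemma norm_sin_eq (z : ℂ) :
    ‖Complex.sin z‖ = ‖Complex.exp (-z * Complex.I) - Complex.exp (z * Complex.I)‖ / 2 := by
  rw [Complex.sin]; simp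

lemma abs_im_le_norm_sin (z : ℂ) : |z.im| ≤ ‖Complex.sin z‖ := by
  have h := abs_norm_sub_norm_le (Complex.exp (-z * Complex.I)) (Complex.exp (z * Complex.I))
  rw [norm_exp_mul_I, norm_exp_mul_I, Complex.neg_im, neg_neg] at h
  have h5 : |Real.sinh z.im| ≤ ‖Complex.sin z‖ := by
    rw [norm_sin_eq, Real.sinh_eq, abs_div, abs_two]; linarith
  refine le_trans ?_ h5
  rcases le_total 0 z.im with h | h
  · rw [abs_of_nonneg h]; exact (Real.self_le_sinh_iff.2 h).trans (le_abs_self _)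
  · rw [abs_of_nonpos h]
    have := Real.sinh_le_self_iff.2 h
    linarith [neg_le_abs (Real.sinh z.im)]

lemma norm_sin_le (z : ℂ) : ‖Complex.sin z‖ ≤ Real.exp |z.im| := by
  have h := norm_sub_le (Complex.exp (-z * Complex.I)) (Complex.exp (z * Complex.I))
  rw [norm_exp_mul_I, norm_exp_mul_I, Complex.neg_im, neg_neg] at h
  have h5 := Real.exp_le_exp.2 (le_abs_self z.im)
  have h6 := Real.exp_le_exp.2 (neg_le_abs z.im)
  rw [norm_sin_eq]; linarith

lemma Gamma_eq_reflection {z : ℂ} (hz : z.im ≠ 0) :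
    Complex.Gamma z = Real.pi / Complex.sin (Real.pi * z) * (Complex.Gamma (1 - z))⁻¹ := by
  rw [← Complex.Gamma_mul_Gamma_one_sub, mul_inv_cancel_right₀]
  refine Complex.Gamma_ne_zero fun m h => hz ?_
  have := congrArg Complex.im h
  simpa using this

/-! ### Mellin-Barnes kernels -/

/-- What a Mellin-Barnes kernel `K` has to satisfy for loop integrals of `K(ξ) z ^ ξ` to converge
and to be independent of the loop, when the abscissae `c` of admissible loops lie in `S` and
satisfy `c < r`, and their heights exceed `t`: it is holomorphic on `Re ξ ≥ c` off the half-strip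
`Re ξ ≥ r`, `|Im ξ| ≤ t` that contains the enclosed poles, and decays faster than any exponential
as `Re ξ → ∞` in the strips `T₁ ≤ |Im ξ| ≤ T₂`, `T₁ > t`. -/
structure LoopKernel (S : Set ℝ) (r t : ℝ) (K : ℂ → ℂ) : Prop where
  nonneg : 0 ≤ t
  differentiableAt : ∀ c ∈ S, ∀ ξ : ℂ, c ≤ ξ.re → (ξ.re < r ∨ t < |ξ.im|) → DifferentiableAt ℂ K ξ
  decay : ∀ c ∈ S, ∀ T₁ T₂ : ℝ, t < T₁ → ∀ A : ℝ, 0 ≤ A → ∃ C, ∀ ξ : ℂ, c ≤ ξ.re →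
    T₁ ≤ |ξ.im| → |ξ.im| ≤ T₂ → ‖K ξ‖ ≤ C * Real.exp (-(A * ξ.re))

namespace LoopKernel

variable {S : Set ℝ} {r t : ℝ} {K : ℂ → ℂ}

lemma decay_mul_cpow (hK : LoopKernel S r t K) {c : ℝ} (hc : c ∈ S) {T₁ T₂ : ℝ} (hT : t < T₁)
    {z : ℂ} (hz : z ≠ 0) : ∃ C, ∀ ξ : ℂ, c ≤ ξ.re → T₁ ≤ |ξ.im| → |ξ.im| ≤ T₂ →
      ‖K ξ * z ^ ξ‖ ≤ C * Real.exp (-ξ.re) := by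
  set ℓ := Real.log ‖z‖ with hℓ
  -- `|z ^ ξ|` grows at most like `exp (ℓ Re ξ)`; the rate `1 + |ℓ|` leaves `exp (-Re ξ)`
  obtain ⟨C, hC⟩ := hK.decay c hc T₁ T₂ hT (1 + |ℓ|) (by positivity)
  refine ⟨|C| * (Real.exp (Real.pi * |T₂|) * Real.exp (2 * |c| * |ℓ|)), fun ξ h1 h2 h3 => ?_⟩
  have hpow : ‖z ^ ξ‖ ≤ Real.exp (ℓ * ξ.re) * Real.exp (Real.pi * |T₂|) := by
    rw [Complex.norm_cpow_of_ne_zero hz, Real.rpow_def_of_pos (norm_pos_iff.2 hz), div_eq_mul_inv,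
      ← Real.exp_neg]
    gcongr
    calc -(z.arg * ξ.im) ≤ |z.arg * ξ.im| := neg_le_abs _
      _ = |z.arg| * |ξ.im| := abs_mul _ _
      _ ≤ _ := mul_le_mul (Complex.abs_arg_le_pi z) (h3.trans (le_abs_self _)) (abs_nonneg _)
          Real.pi_pos.le
  have hexp : -((1 + |ℓ|) * ξ.re) + ℓ * ξ.re ≤ 2 * |c| * |ℓ| + -ξ.re := by
    have e1 : 0 ≤ |ℓ| - ℓ := by linarith [le_abs_self ℓ]
    have e2 : |ℓ| - ℓ ≤ 2 * |ℓ| := by linarith [neg_abs_le ℓ]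
    have e3 : -ξ.re ≤ |c| := by linarith [neg_abs_le c]
    have e4 : (|ℓ| - ℓ) * (-ξ.re) ≤ (2 * |ℓ|) * |c| :=
      (mul_le_mul_of_nonneg_left e3 e1).trans (mul_le_mul_of_nonneg_right e2 (abs_nonneg c))
    linarith
  calc ‖K ξ * z ^ ξ‖ ≤ (|C| * Real.exp (-((1 + |ℓ|) * ξ.re))) *
        (Real.exp (ℓ * ξ.re) * Real.exp (Real.pi * |T₂|)) := by
        rw [norm_mul]
        refine mul_le_mul ((hC ξ h1 h2 h3).trans ?_) hpow (norm_nonneg _) (by positivity)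
        gcongr; exact le_abs_self C
    _ = |C| * (Real.exp (Real.pi * |T₂|) * Real.exp (-((1 + |ℓ|) * ξ.re) + ℓ * ξ.re)) := by
        rw [Real.exp_add]; ring
    _ ≤ |C| * (Real.exp (Real.pi * |T₂|) * Real.exp (2 * |c| * |ℓ| + -ξ.re)) := by gcongr
    _ = _ := by rw [Real.exp_add]; ring

lemma differentiableAt_mul_cpow (hK : LoopKernel S r t K) {c : ℝ} (hc : c ∈ S) {z : ℂ}
    (hz : z ≠ 0) {ξ : ℂ} (h1 : c ≤ ξ.re) (h2 : ξ.re < r ∨ t < |ξ.im|) :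
    DifferentiableAt ℂ (fun ξ => K ξ * z ^ ξ) ξ :=
  (hK.differentiableAt c hc ξ h1 h2).mul (differentiableAt_id.const_cpow (Or.inl hz))

lemma loopIntegral_congr (hK : LoopKernel S r t K) {c₁ c₂ T₁ T₂ : ℝ} (hc₁ : c₁ ∈ S) (hc₂ : c₂ ∈ S)
    (hr₁ : c₁ < r) (hr₂ : c₂ < r) (hT₁ : t < T₁) (hT₂ : t < T₂) {z : ℂ} (hz : z ≠ 0) :
    loopIntegral c₁ T₁ (fun ξ => K ξ * z ^ ξ) = loopIntegral c₂ T₂ (fun ξ => K ξ * z ^ ξ) := by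
  have hc : min c₁ c₂ ∈ S := by rcases min_choice c₁ c₂ with h | h <;> rwa [h]
  obtain ⟨C, hC⟩ := hK.decay_mul_cpow hc (T₂ := max T₁ T₂) (lt_min hT₁ hT₂) hz
  refine _root_.loopIntegral_congr (hK.nonneg.trans_lt hT₁) (hK.nonneg.trans_lt hT₂)
    (fun ξ h1 h2 => hK.differentiableAt_mul_cpow hc hz h1 ?_) hC
  rcases h2 with h2 | h2
  · exact Or.inl (h2.trans_lt (max_lt hr₁ hr₂))
  · exact Or.inr ((lt_min hT₁ hT₂).trans_le h2)

lemma path_mem (hK : LoopKernel S r t K) {c T : ℝ} (hr : c < r) (hT : t < T) (y : ℝ) :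
    (loopPath c T y).re < r ∨ t < |(loopPath c T y).im| := by
  rcases loopPath_mem (hK.nonneg.trans_lt hT) c y with h | h
  · exact Or.inl (by rw [h]; exact hr)
  · exact Or.inr (by rw [h]; exact hT)

lemma integrable (hK : LoopKernel S r t K) {c T : ℝ} (hc : c ∈ S) (hr : c < r) (hT : t < T)
    {z : ℂ} (hz : z ≠ 0) :
    Integrable (fun y => K (loopPath c T y) * z ^ loopPath c T y * loopSpeed T y) := by
  obtain ⟨C, hC⟩ := hK.decay_mul_cpow hc (T₂ := T) hT hz
  exact integrable_loop (F := fun ξ => K ξ * z ^ ξ) (hK.nonneg.trans_lt hT)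
    (fun y => (hK.differentiableAt_mul_cpow hc hz (le_loopPath_re c T y)
      (hK.path_mem hr hT y)).continuousAt) (fun ξ h1 h2 => hC ξ h1 h2.ge h2.le)

lemma measurable_path (hK : LoopKernel S r t K) {c T : ℝ} (hc : c ∈ S) (hr : c < r) (hT : t < T) :
    Measurable (fun y => K (loopPath c T y)) := by
  refine Continuous.measurable (continuous_iff_continuousAt.2 fun y => ?_)
  exact ContinuousAt.comp (g := K) (hK.differentiableAt c hc _ (le_loopPath_re c T y)
    (hK.path_mem hr hT y)).continuousAt (continuous_loopPath c T).continuousAt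

end LoopKernel

/-- The density of `(2πi)⁻¹ K(ξ) dξ` along `loopPath c T`. -/
noncomputable def loopWeight (K : ℂ → ℂ) (c T y : ℝ) : ℂ :=
  1 / (2 * Real.pi * Complex.I) * K (loopPath c T y) * loopSpeed T y

/-- The value of `foxH`, defined through an unspecified admissible loop, as an integral along any
given admissible loop. -/
lemma LoopKernel.foxH_eq {S : Set ℝ} {r t : ℝ} {p q m n : ℕ} {A : Fin p → ℂ × ℝ}
    {B : Fin q → ℂ × ℝ} (hK : LoopKernel S r t (foxKernel m n A B))
    (hL : ∀ c T, IsFoxLoop m n A B c T → c ∈ S ∧ c < r ∧ t < T) {c T : ℝ}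
    (h : IsFoxLoop m n A B c T) {z : ℂ} (hz : z ≠ 0) :
    foxH m n A B z = ∫ y, loopWeight (foxKernel m n A B) c T y * z ^ loopPath c T y := by
  have hex : ∃ L : ℝ × ℝ, IsFoxLoop m n A B L.1 L.2 := ⟨(c, T), h⟩
  obtain ⟨a1, a2, a3⟩ := hL _ _ hex.choose_spec
  obtain ⟨b1, b2, b3⟩ := hL _ _ h
  have e1 : foxH m n A B z = loopIntegral hex.choose.1 hex.choose.2
      (fun ξ => foxKernel m n A B ξ * z ^ ξ) := by
    unfold foxH; exact dif_pos hex
  have e2 := hK.loopIntegral_congr a1 b1 a2 b2 a3 b3 hz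
  have e3 := loopIntegral_eq_integral (F := fun ξ => foxKernel m n A B ξ * z ^ ξ) h.pos
    (hK.integrable b1 b2 b3 hz)
  rw [e1, e2, e3, ← integral_const_mul]
  refine integral_congr_ae (ae_of_all _ fun y => ?_)
  simp only [loopWeight]; ring

lemma LoopKernel.integrable_loopWeight {S : Set ℝ} {r t : ℝ} {K : ℂ → ℂ}
    (hK : LoopKernel S r t K) {c T : ℝ} (hc : c ∈ S) (hr : c < r) (hT : t < T)
    {z : ℂ} (hz : z ≠ 0) : Integrable (fun y => loopWeight K c T y * z ^ loopPath c T y) := by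
  refine ((hK.integrable hc hr hT hz).const_mul (1 / (2 * Real.pi * Complex.I))).congr
    (ae_of_all _ fun y => ?_)
  simp only [loopWeight]; ring

lemma LoopKernel.measurable_loopWeight {S : Set ℝ} {r t : ℝ} {K : ℂ → ℂ}
    (hK : LoopKernel S r t K) {c T : ℝ} (hc : c ∈ S) (hr : c < r) (hT : t < T) :
    Measurable (loopWeight K c T) :=
  ((hK.measurable_path hc hr hT).const_mul _).mul (measurable_loopSpeed T)

/-! ### Fractional integration of Mellin-Barnes kernels -/

lemma mul_ofReal_cpow {w : ℂ} (hw : w ≠ 0) {r : ℝ} (hr : 0 < r) (ξ : ℂ) :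
    (w * r) ^ ξ = w ^ ξ * (r : ℂ) ^ ξ := by
  have hr' : (r : ℂ) ≠ 0 := Complex.ofReal_ne_zero.2 hr.ne'
  rw [Complex.cpow_def_of_ne_zero (mul_ne_zero hw hr'), Complex.cpow_def_of_ne_zero hw,
    Complex.cpow_def_of_ne_zero hr', Complex.log_mul_ofReal r hr w hw, Complex.ofReal_log hr.le,
    ← Complex.exp_add]
  ring_nf

lemma rpow_cpow {s : ℝ} (hs : 0 < s) (α : ℝ) (ξ : ℂ) :
    ((s ^ α : ℝ) : ℂ) ^ ξ = (s : ℂ) ^ (α * ξ) := by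
  have hs' : (s : ℂ) ≠ 0 := Complex.ofReal_ne_zero.2 hs.ne'
  rw [Complex.cpow_def_of_ne_zero hs', Complex.cpow_def_of_ne_zero
    (Complex.ofReal_ne_zero.2 (Real.rpow_pos_of_pos hs α).ne'),
    ← Complex.ofReal_log (by positivity),
    Real.log_rpow hs, ← Complex.ofReal_log hs.le]
  push_cast; ring_nf

lemma posPow_mul_cpow {w : ℂ} (hw : w ≠ 0) (κ : ℂ) (α : ℝ) (ξ : ℂ) (s : ℝ) :
    posPow κ s * (w * ((s ^ α : ℝ) : ℂ)) ^ ξ = w ^ ξ * posPow (κ + α * ξ) s := by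
  unfold posPow
  split_ifs with hs
  · have hs' : (s : ℂ) ≠ 0 := Complex.ofReal_ne_zero.2 hs.ne'
    rw [mul_ofReal_cpow hw (by positivity), rpow_cpow hs, mul_left_comm, ← Complex.cpow_add _ _ hs']
    ring_nf
  · simp

/-- For `s < u` and `Re ξ ≥ c`, the size of `s ^ (κ - 1) (w s ^ α) ^ ξ` is controlled by a power
of `s` independent of `ξ` times `|(w u ^ α) ^ ξ|`. The argument of `w s ^ α` does not depend on
`s`. -/
lemma enorm_posPow_mul_cpow_le {w : ℂ} (hw : w ≠ 0) (κ : ℂ) {α c : ℝ} (hα : 0 < α) {ξ : ℂ}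
    (hξ : c ≤ ξ.re) {s u : ℝ} (hu : 0 < u) (hsu : s < u) :
    ‖posPow κ s * (w * ((s ^ α : ℝ) : ℂ)) ^ ξ‖ₑ ≤
      posPowE (κ.re + α * c) s *
        (ENNReal.ofReal (u ^ (-(α * c))) * ‖(w * ((u ^ α : ℝ) : ℂ)) ^ ξ‖ₑ) := by
  rw [posPow_mul_cpow hw, enorm_mul, enorm_posPow]
  unfold posPowE
  split_ifs with hs
  · rw [mul_ofReal_cpow hw (by positivity), rpow_cpow hu, enorm_mul,
      ← ofReal_norm (x := (u : ℂ) ^ _), Complex.norm_cpow_eq_rpow_re_of_pos hu,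
      mul_left_comm (ENNReal.ofReal _) ‖w ^ ξ‖ₑ, mul_left_comm _ ‖w ^ ξ‖ₑ]
    gcongr
    rw [← ENNReal.ofReal_mul (by positivity), ← ENNReal.ofReal_mul (by positivity)]
    apply ENNReal.ofReal_le_ofReal
    rw [← Real.rpow_add hu]
    have e1 : ((α : ℂ) * ξ).re = α * ξ.re := by simp
    rw [Complex.add_re, e1, show κ.re + α * ξ.re - 1 = (κ.re + α * c - 1) + α * (ξ.re - c) by ring,
      Real.rpow_add hs, show -(α * c) + α * ξ.re = α * (ξ.re - c) by ring]
    gcongr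
  · simp

section MellinKernel

variable {G ξ : ℝ → ℂ} {w : ℂ} {α c : ℝ}

/-- The kernel `u ^ (κ - 1) ∫ G(y) (w u ^ α) ^ ξ(y) dy`, `u > 0`: with `G` and `ξ` the density and
the path of a loop it is `u ^ (κ - 1) H[w u ^ α]`. -/
noncomputable def mellinKer (w : ℂ) (α : ℝ) (κ : ℂ) (G ξ : ℝ → ℂ) (u : ℝ) : ℂ :=
  posPow κ u * ∫ y, G y * (w * ((u ^ α : ℝ) : ℂ)) ^ ξ y

lemma powerBound_mellinKer (hG : Measurable G) (hξ : Measurable ξ) (hc : ∀ y, c ≤ (ξ y).re)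
    (hw : w ≠ 0) (hα : 0 < α) (hi : ∀ z : ℂ, z ≠ 0 → Integrable (fun y => G y * z ^ ξ y)) (κ : ℂ)
    {L : ℝ} (hL : 0 < L) : PowerBound L (κ.re + α * c) (mellinKer w α κ G ξ) := by
  have hz : w * ((L ^ α : ℝ) : ℂ) ≠ 0 :=
    mul_ne_zero hw (Complex.ofReal_ne_zero.2 (by positivity))
  refine ⟨?_, ENNReal.ofReal (L ^ (-(α * c))) * ∫⁻ y, ‖G y * (w * ((L ^ α : ℝ) : ℂ)) ^ ξ y‖ₑ,
    ENNReal.mul_ne_top (by simp) (hi _ hz).hasFiniteIntegral.ne, fun u hu => ?_⟩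
  · refine (measurable_posPow κ).mul (StronglyMeasurable.measurable ?_)
    refine StronglyMeasurable.integral_prod_right (f := fun (u y : ℝ) =>
      G y * (w * ((u ^ α : ℝ) : ℂ)) ^ ξ y) (Measurable.stronglyMeasurable ?_)
    simp only [Function.uncurry_def]
    fun_prop
  · rw [mellinKer, ← integral_const_mul]
    refine (enorm_integral_le_lintegral_enorm _).trans ?_
    rw [mul_comm (_ * _), ← mul_assoc, ← lintegral_const_mul' _ _
      (ENNReal.mul_ne_top (posPowE_ne_top _ _) (by simp))]
    refine lintegral_mono fun y => ?_
    rw [mul_left_comm, enorm_mul (G y), enorm_mul (G y)]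
    grw [enorm_posPow_mul_cpow_le hw κ hα (hc y) hL hu]
    apply le_of_eq; ring

/-- Fractional integration of a kernel `u ^ (κ - 1) H[w u ^ α]` multiplies the Mellin-Barnes
density by `Γ(κ + αξ) / Γ(κ + αξ + μ)`, term by term under the loop integral. -/
lemma volterra_mellinKer_rlKer (hG : Measurable G) (hξ : Measurable ξ) (hc : ∀ y, c ≤ (ξ y).re)
    (hw : w ≠ 0) (hα : 0 < α) (hi : ∀ z : ℂ, z ≠ 0 → Integrable (fun y => G y * z ^ ξ y))
    {κ μ : ℂ} (hκ : 0 < κ.re + α * c) (hμ : 0 < μ.re) :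
    volterra (mellinKer w α κ G ξ) (rlKer μ) = mellinKer w α (κ + μ)
      (fun y => G y * (Complex.Gamma (κ + α * ξ y) / Complex.Gamma (κ + α * ξ y + μ))) ξ := by
  ext u
  rcases le_or_gt u 0 with hu | hu
  · rw [volterra_eq_zero_of_le (a := 0) (fun v hv => by simp [mellinKer, posPow, hv.not_gt])
      (fun v hv => rlKer_of_nonpos _ hv) hu]
    simp [mellinKer, posPow, hu.not_gt]
  have hz : w * ((u ^ α : ℝ) : ℂ) ≠ 0 :=
    mul_ne_zero hw (Complex.ofReal_ne_zero.2 (by positivity))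
  have hint : Integrable (Function.uncurry fun t y : ℝ => G y *
      (posPow κ (u - t) * (w * (((u - t) ^ α : ℝ) : ℂ)) ^ ξ y) * rlKer μ t)
      (volume.prod volume) := by
    have m1 := measurable_posPow κ
    have m2 := (powerBound_rlKer 0 μ).measurable
    have m3 := measurable_posPowE (κ.re + α * c)
    have m4 := measurable_posPowE μ.re
    have hm : Measurable (Function.uncurry fun t y : ℝ => G y *
        (posPow κ (u - t) * (w * (((u - t) ^ α : ℝ) : ℂ)) ^ ξ y) * rlKer μ t) := by
      simp only [Function.uncurry_def]
      fun_prop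
    refine ⟨hm.aestronglyMeasurable, ?_⟩
    rw [hasFiniteIntegral_iff_enorm, lintegral_prod _ hm.enorm.aemeasurable]
    set Z := ENNReal.ofReal (u ^ (-(α * c))) * ∫⁻ y, ‖G y * (w * ((u ^ α : ℝ) : ℂ)) ^ ξ y‖ₑ with hZ
    have hZt : Z < ⊤ := ENNReal.mul_lt_top (by simp) (hi _ hz).hasFiniteIntegral
    refine lt_of_le_of_lt (b := ∫⁻ t, (Z * ‖(Complex.Gamma μ)⁻¹‖ₑ) *
      (posPowE (κ.re + α * c) (u - t) * posPowE μ.re (t - 0))) ?_ ?_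
    · refine lintegral_mono fun t => ?_
      simp only [Function.uncurry_apply_pair]
      rcases le_or_gt t 0 with ht | ht
      · simp [rlKer_of_nonpos _ ht]
      calc _ ≤ ∫⁻ y, (ENNReal.ofReal (u ^ (-(α * c))) * posPowE (κ.re + α * c) (u - t) *
              ‖rlKer μ t‖ₑ) * ‖G y * (w * ((u ^ α : ℝ) : ℂ)) ^ ξ y‖ₑ := by
            refine lintegral_mono fun y => ?_
            rw [enorm_mul, enorm_mul, enorm_mul (G y)]
            grw [enorm_posPow_mul_cpow_le hw κ hα (hc y) hu (by linarith : u - t < u)]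
            apply le_of_eq; ring
        _ = _ := by
            rw [lintegral_const_mul' _ _ (ENNReal.mul_ne_top (ENNReal.mul_ne_top (by simp)
              (posPowE_ne_top _ _)) (by simp)), hZ, rlKer, enorm_mul, enorm_posPow, sub_zero]
            ring
    · rw [lintegral_const_mul' _ _ (ENNReal.mul_ne_top hZt.ne (by simp)),
        lintegral_posPowE_mul hκ hμ]
      exact ENNReal.mul_lt_top (ENNReal.mul_lt_top hZt (by simp))
        (ENNReal.mul_lt_top (by simp) (posPowE_ne_top _ _).lt_top)
  have hsw := integral_integral_swap hint
  have hre (y : ℝ) : 0 < (κ + α * ξ y).re := by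
    have e1 : ((α : ℂ) * ξ y).re = α * (ξ y).re := by simp
    rw [Complex.add_re, e1]
    have := mul_le_mul_of_nonneg_left (hc y) hα.le
    linarith
  calc volterra (mellinKer w α κ G ξ) (rlKer μ) u = ∫ t, ∫ y, G y *
        (posPow κ (u - t) * (w * (((u - t) ^ α : ℝ) : ℂ)) ^ ξ y) * rlKer μ t := by
        unfold volterra mellinKer
        congr 1; ext t
        rw [integral_mul_const, ← integral_const_mul]
        congr 2; ext y; ring
    _ = ∫ y, ∫ t, G y *
        (posPow κ (u - t) * (w * (((u - t) ^ α : ℝ) : ℂ)) ^ ξ y) * rlKer μ t := hsw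
    _ = ∫ y, posPow (κ + μ) u * (G y * (Complex.Gamma (κ + α * ξ y) /
          Complex.Gamma (κ + α * ξ y + μ)) * (w * ((u ^ α : ℝ) : ℂ)) ^ ξ y) := by
        congr 1; ext y
        have h1 : ∫ t, G y * (posPow κ (u - t) * (w * (((u - t) ^ α : ℝ) : ℂ)) ^ ξ y) * rlKer μ t =
            G y * w ^ ξ y * volterra (posPow (κ + α * ξ y)) (rlKer μ) u := by
          rw [volterra, ← integral_const_mul]
          congr 1; ext t
          rw [posPow_mul_cpow hw]; ring
        have h2 := Complex.Gamma_ne_zero_of_re_pos hμ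
        rw [h1, show rlKer μ = fun u => (Complex.Gamma μ)⁻¹ * posPow μ u from rfl,
          volterra_const_mul_right, volterra_posPow,
          Complex.betaIntegral_eq_Gamma_mul_div _ _ hμ (hre y)]
        have h3 := posPow_mul_cpow hw (κ + μ) α (ξ y) u
        rw [show κ + μ + α * ξ y = κ + α * ξ y + μ by ring] at h3
        rw [mul_left_comm (posPow (κ + μ) u), h3, add_comm μ (κ + α * ξ y)]
        field_simp
    _ = _ := by rw [mellinKer, ← integral_const_mul]

end MellinKernel

/-! ### The two Fox kernels -/

/-- A decay estimate for large `Re ξ` extends to `Re ξ ≥ c`, the rest being compact. -/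
lemma exists_decay_of_large {K : ℂ → ℂ} {c X T₁ T₂ A : ℝ}
    (hK : ∀ ξ : ℂ, c ≤ ξ.re → T₁ ≤ |ξ.im| → ContinuousAt K ξ)
    (h : ∃ C, ∀ ξ : ℂ, c ≤ ξ.re → X ≤ ξ.re → T₁ ≤ |ξ.im| → |ξ.im| ≤ T₂ →
      ‖K ξ‖ ≤ C * Real.exp (-(A * ξ.re))) :
    ∃ C, ∀ ξ : ℂ, c ≤ ξ.re → T₁ ≤ |ξ.im| → |ξ.im| ≤ T₂ → ‖K ξ‖ ≤ C * Real.exp (-(A * ξ.re)) := by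
  obtain ⟨C, hC⟩ := h
  have hcomp : IsCompact ({ξ : ℂ | c ≤ ξ.re ∧ ξ.re ≤ X ∧ |ξ.im| ≤ T₂} ∩ {ξ : ℂ | T₁ ≤ |ξ.im|}) :=
    (isCompact_strip c X T₂).inter_right (isClosed_le continuous_const (by fun_prop))
  obtain ⟨M, hM⟩ := hcomp.exists_bound_of_continuousOn
    (f := fun ξ => K ξ * (Real.exp (A * ξ.re) : ℂ)) (fun ξ hξ =>
      ((hK ξ hξ.1.1 hξ.2).mul (by fun_prop)).continuousWithinAt)
  refine ⟨max C M, fun ξ h1 h2 h3 => ?_⟩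
  rcases le_total X ξ.re with h4 | h4
  · refine (hC ξ h1 h4 h2 h3).trans ?_
    gcongr; exact le_max_left _ _
  · have := hM ξ ⟨⟨h1, h4, h3⟩, h2⟩
    rw [norm_mul, Complex.norm_real, Real.norm_of_nonneg (Real.exp_pos _).le] at this
    rw [Real.exp_neg, ← div_eq_mul_inv, le_div_iff₀ (Real.exp_pos _)]
    exact this.trans (le_max_right _ _)

lemma foxKernel_macdonald (η ν : ℝ) (σ ξ : ℂ) :
    foxKernel 2 0 (macdonaldUpper η ν) (macdonaldLower η σ ν) ξ =
      Complex.Gamma (-ξ) * Complex.Gamma (-σ - ν / η - ξ / η) *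
        (Complex.Gamma (1 - (ν + 1) / η - ξ / η))⁻¹ := by
  simp [foxKernel, macdonaldUpper, macdonaldLower, Fin.prod_univ_two, div_eq_inv_mul]

/-- To the right of the poles of `Γ(β + N - μ + αξ)` this factor cancels; at those poles
`Complex.Gamma` is `0` and the kernel would take the junk value `0`. -/
lemma foxKernel_composed (η ν α : ℝ) (σ β μ ξ : ℂ)
    (h : 0 < (β + (rlOrder μ : ℂ) - μ + α * ξ).re) :
    foxKernel 2 2 (composedUpper η ν α β μ) (composedLower η σ ν α β μ) ξ =
      foxKernel 2 0 (macdonaldUpper η ν) (macdonaldLower η σ ν) ξ *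
        (Complex.Gamma (β + α * ξ) * (Complex.Gamma (β - μ + α * ξ))⁻¹) := by
  have h1 := Complex.Gamma_ne_zero_of_re_pos h
  have e1 : 1 - (1 - β - (rlOrder μ : ℂ) + μ) + α * ξ = β + (rlOrder μ : ℂ) - μ + α * ξ := by ring
  have e2 : 1 - (1 - β + μ) + α * ξ = β - μ + α * ξ := by ring
  rw [foxKernel_macdonald]
  simp only [foxKernel, composedUpper, composedLower, Fin.prod_univ_four, Fin.prod_univ_three]
  simp [e1, e2]
  generalize Complex.Gamma (β + (rlOrder μ : ℂ) - μ + α * ξ) = X at h1 ⊢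
  field_simp

lemma isFoxLoop_macdonald {η ν : ℝ} (hη : 0 < η) {σ : ℂ} {c T : ℝ} :
    IsFoxLoop 2 0 (macdonaldUpper η ν) (macdonaldLower η σ ν) c T ↔
      c < min 0 (-(η * σ.re + ν)) ∧ η * |σ.im| < T := by
  have e : ((-σ - ν / η) / ((1 / η : ℝ) : ℂ)).re = -(η * σ.re + ν) ∧
      ((-σ - ν / η) / ((1 / η : ℝ) : ℂ)).im = -(η * σ.im) := by
    rw [Complex.div_ofReal_re, Complex.div_ofReal_im]
    constructor <;> simp [Complex.div_ofReal_re, Complex.div_ofReal_im] <;> field_simp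
    ring
  have e' : |-(η * σ.im)| = η * |σ.im| := by rw [abs_neg, abs_mul, abs_of_pos hη]
  constructor
  · rintro ⟨-, hr, -⟩
    have h0 := (hr 0 (by simp)).1
    have h1 := hr 1 (by simp)
    simp only [macdonaldLower, Matrix.cons_val_zero, Matrix.cons_val_one] at h0 h1
    rw [e.1, e.2, e'] at h1
    exact ⟨lt_min (by simpa using h0) h1.1, h1.2⟩
  · rintro ⟨h1, h2⟩
    have hT : 0 < T := lt_of_le_of_lt (by positivity) h2
    refine ⟨hT, fun j _ => ?_, fun j hj => absurd hj (by simp)⟩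
    fin_cases j
    · simpa [macdonaldLower] using ⟨h1.trans_le (min_le_left _ _), hT⟩
    · change c < ((-σ - ν / η) / ((1 / η : ℝ) : ℂ)).re ∧ |((-σ - ν / η) / ((1 / η : ℝ) : ℂ)).im| < T
      rw [e.1, e.2, e']
      exact ⟨h1.trans_le (min_le_right _ _), h2⟩

lemma isFoxLoop_composed {η ν α : ℝ} (hη : 0 < η) {σ β μ : ℂ} {c T : ℝ} :
    IsFoxLoop 2 2 (composedUpper η ν α β μ) (composedLower η σ ν α β μ) c T ↔
      (-((β.re + rlOrder μ - μ.re) / α) < c ∧ -(β.re / α) < c) ∧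
        c < min 0 (-(η * σ.re + ν)) ∧ η * |σ.im| < T := by
  rw [← isFoxLoop_macdonald hη]
  have l0 : (((1 - β - (rlOrder μ : ℂ) + μ) - 1) / (α : ℂ)).re =
      -((β.re + rlOrder μ - μ.re) / α) := by
    rw [Complex.div_ofReal_re]; simp; ring
  have l1 : (((1 - β) - 1) / (α : ℂ)).re = -(β.re / α) := by
    rw [Complex.div_ofReal_re]; simp; ring
  constructor
  · rintro ⟨hT, hr, hl⟩
    refine ⟨⟨?_, ?_⟩, hT, fun j hj => ?_, fun j hj => absurd hj (by simp)⟩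
    · rw [← l0]; exact hl 0 (by simp)
    · rw [← l1]; exact hl 1 (by simp)
    · fin_cases j
      · exact hr 0 (by simp)
      · exact hr 1 (by simp)
  · rintro ⟨⟨h0, h1⟩, hT, hr, -⟩
    refine ⟨hT, fun j hj => ?_, fun j hj => ?_⟩
    · fin_cases j
      · exact hr 0 (by simp)
      · exact hr 1 (by simp)
      · simp at hj
      · simp at hj
    · fin_cases j
      · exact l0.trans_lt h0
      · exact l1.trans_lt h1
      · simp at hj

lemma differentiableAt_foxKernel_macdonald {η ν : ℝ} (hη : 0 < η) {σ ξ : ℂ}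
    (h : ξ.re < min 0 (-(η * σ.re + ν)) ∨ η * |σ.im| < |ξ.im|) :
    DifferentiableAt ℂ (foxKernel 2 0 (macdonaldUpper η ν) (macdonaldLower η σ ν)) ξ := by
  rw [funext (foxKernel_macdonald η ν σ)]
  have g (z : ℂ) (hz : 0 < z.re ∨ z.im ≠ 0) : DifferentiableAt ℂ Complex.Gamma z := by
    refine Complex.differentiableAt_Gamma z fun m hm => ?_
    rw [hm] at hz
    simp at hz
    linarith [m.cast_nonneg (α := ℝ)]
  have e1 : (-σ - ν / η - ξ / η).re = (-(η * σ.re + ν) - ξ.re) / η := by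
    simp [Complex.div_ofReal_re]; field_simp; ring
  have e2 : (-σ - ν / η - ξ / η).im = -(η * σ.im + ξ.im) / η := by
    simp [Complex.div_ofReal_im]; field_simp; ring
  refine ((DifferentiableAt.comp ξ (g _ ?_) (by fun_prop)).mul
    (DifferentiableAt.comp ξ (g _ ?_) (by fun_prop))).mul
      ((Complex.differentiable_one_div_Gamma.comp
        (f := fun x : ℂ => 1 - ((ν : ℂ) + 1) / η - x / η) (by fun_prop)) ξ)
  · rcases h with h | h
    · left; have := h.trans_le (min_le_left _ _); simpa
    · right; have := abs_pos.1 ((by positivity : 0 ≤ η * |σ.im|).trans_lt h); simpa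
  · rcases h with h | h
    · left; rw [e1]
      have := h.trans_le (min_le_right _ _)
      exact div_pos (by linarith) hη
    · right; rw [e2]
      intro h0
      rw [div_eq_zero_iff, or_iff_left hη.ne'] at h0
      rw [show ξ.im = -(η * σ.im) by linarith, abs_neg, abs_mul, abs_of_pos hη] at h
      exact lt_irrefl _ h

/-- By the reflection formula the Macdonald kernel is a quotient of sines, bounded on the strips,
times `1 / Γ(1 + ξ)` and `Γ(p) / Γ(p + δ)` with `p = (ν + 1 + ξ) / η` and `δ = 1 + σ - 1 / η`. The
hypothesis on `σ` is `Re δ > 0`, which makes the last factor bounded. -/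
lemma loopKernel_macdonald {η ν : ℝ} (hη : 0 < η) {σ : ℂ} (hσ : 1 / η - 1 < σ.re) :
    LoopKernel Set.univ (min 0 (-(η * σ.re + ν))) (η * |σ.im|)
      (foxKernel 2 0 (macdonaldUpper η ν) (macdonaldLower η σ ν)) where
  nonneg := by positivity
  differentiableAt c _ ξ _ h := differentiableAt_foxKernel_macdonald hη h
  decay c _ T₁ T₂ hT A hA := by
    have ht : 0 ≤ η * |σ.im| := by positivity
    -- `Re ξ ≥ η - ν - 1` is `Re p ≥ 1`
    refine exists_decay_of_large (X := max 0 (η - ν - 1)) (fun ξ _ h =>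
      (differentiableAt_foxKernel_macdonald hη (Or.inr (hT.trans_le h))).continuousAt) ?_
    have hδ : 0 < (1 + σ - 1 / (η : ℂ)).re := by
      rw [← Complex.ofReal_one, ← Complex.ofReal_div]
      simp only [Complex.sub_re, Complex.add_re, Complex.ofReal_re]; linarith
    obtain ⟨C₁, hC₁⟩ := exists_norm_inv_Gamma_le 1 T₂ hA
    obtain ⟨C₂, hC₂⟩ := exists_norm_Gamma_mul_inv_Gamma_le hδ one_pos
    set s := Real.pi * T₁ with hs
    set s' := Real.pi * ((T₁ - η * |σ.im|) / η) with hs'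
    have hs0 : 0 < s := mul_pos Real.pi_pos (by linarith)
    have hs0' : 0 < s' := mul_pos Real.pi_pos (div_pos (by linarith) hη)
    refine ⟨Real.pi / s * |C₁| * (Real.exp (Real.pi * (T₂ / η)) / s' * |C₂|),
      fun ξ _ hX h1 h2 => ?_⟩
    have hξim : ξ.im ≠ 0 := fun h => by rw [h, abs_zero] at h1; linarith
    set p : ℂ := (ν + 1) / η + ξ / η with hp
    set z : ℂ := -σ - ν / η - ξ / η with hz
    have hη' : (η : ℂ) ≠ 0 := Complex.ofReal_ne_zero.2 hη.ne'
    have pre : 1 ≤ p.re := by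
      have e : p.re = (ν + 1 + ξ.re) / η := by
        simp [hp, ← Complex.ofReal_one, ← Complex.ofReal_add, Complex.div_ofReal_re]
        ring
      rw [e, one_le_div hη]
      have := (le_max_right 0 (η - ν - 1)).trans hX
      linarith
    have pim : p.im = ξ.im / η := by
      simp [hp, Complex.div_ofReal_im]
    have zim : z.im = -(η * σ.im + ξ.im) / η := by
      simp [hz, Complex.div_ofReal_im]; field_simp; ring
    have zabs : (T₁ - η * |σ.im|) / η ≤ |z.im| := by
      rw [zim, abs_div, abs_neg, abs_of_pos hη]
      gcongr
      have := abs_sub_abs_le_abs_sub ξ.im (-(η * σ.im))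
      rw [abs_neg, abs_mul, abs_of_pos hη, sub_neg_eq_add, add_comm] at this
      linarith
    have zim0 : z.im ≠ 0 := by
      rw [← abs_pos]; exact (div_pos (by linarith) hη).trans_le zabs
    have pim0 : p.im ≠ 0 := by rw [pim]; exact div_ne_zero hξim hη.ne'
    have r1 := Gamma_eq_reflection (z := -ξ) (by simpa using hξim)
    have r2 := Gamma_eq_reflection zim0
    have r3 : (Complex.Gamma (1 - (ν + 1) / η - ξ / η))⁻¹ =
        Complex.sin (Real.pi * p) / Real.pi * Complex.Gamma p := by
      have hsin : Complex.sin (Real.pi * p) ≠ 0 := by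
        rw [← norm_pos_iff]
        refine lt_of_lt_of_le ?_ (abs_im_le_norm_sin _)
        simpa [Real.pi_ne_zero] using pim0
      have hpi : (Real.pi : ℂ) ≠ 0 := Complex.ofReal_ne_zero.2 Real.pi_ne_zero
      rw [Gamma_eq_reflection pim0, show 1 - (ν + 1) / η - ξ / η = 1 - p by rw [hp]; ring]
      generalize Complex.sin (Real.pi * p) = S at hsin ⊢
      field_simp
    have hzp : 1 - z = p + (1 + σ - 1 / (η : ℂ)) := by rw [hz, hp]; field_simp; ring
    rw [foxKernel_macdonald, ← hz, r1, r2, r3, hzp]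
    have hpi : (Real.pi : ℂ) ≠ 0 := Complex.ofReal_ne_zero.2 Real.pi_ne_zero
    have split : Real.pi / Complex.sin (Real.pi * -ξ) * (Complex.Gamma (1 - -ξ))⁻¹ *
        (Real.pi / Complex.sin (Real.pi * z) * (Complex.Gamma (p + (1 + σ - 1 / (η : ℂ))))⁻¹) *
        (Complex.sin (Real.pi * p) / Real.pi * Complex.Gamma p) =
        (Real.pi / Complex.sin (Real.pi * -ξ) * (Complex.Gamma (1 - -ξ))⁻¹) *
        (Complex.sin (Real.pi * p) / Complex.sin (Real.pi * z) *
          (Complex.Gamma p * (Complex.Gamma (p + (1 + σ - 1 / (η : ℂ))))⁻¹)) := by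
      field_simp
    rw [split, norm_mul, norm_mul, norm_mul, norm_div, norm_div, Complex.norm_real,
      Real.norm_of_nonneg Real.pi_pos.le]
    have b1 : s ≤ ‖Complex.sin (Real.pi * -ξ)‖ := by
      refine le_trans ?_ (abs_im_le_norm_sin _)
      rw [Complex.im_ofReal_mul, abs_mul, abs_of_pos Real.pi_pos, Complex.neg_im, abs_neg]
      exact mul_le_mul_of_nonneg_left h1 Real.pi_pos.le
    have b2 : s' ≤ ‖Complex.sin (Real.pi * z)‖ := by
      refine le_trans ?_ (abs_im_le_norm_sin _)
      rw [Complex.im_ofReal_mul, abs_mul, abs_of_pos Real.pi_pos]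
      exact mul_le_mul_of_nonneg_left zabs Real.pi_pos.le
    have b3 : ‖Complex.sin (Real.pi * p)‖ ≤ Real.exp (Real.pi * (T₂ / η)) := by
      refine (norm_sin_le _).trans (Real.exp_le_exp.2 ?_)
      rw [Complex.im_ofReal_mul, abs_mul, abs_of_pos Real.pi_pos, pim, abs_div, abs_of_pos hη]
      gcongr
    have b4 : ‖(Complex.Gamma (1 - -ξ))⁻¹‖ ≤ |C₁| * Real.exp (-(A * ξ.re)) := by
      have h0 : 0 ≤ ξ.re := (le_max_left _ _).trans hX
      refine (hC₁ (1 - -ξ) (by simpa using h0) (by simpa using h2)).trans ?_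
      refine mul_le_mul (le_abs_self _) (Real.exp_le_exp.2 ?_) (by positivity) (abs_nonneg _)
      simp only [sub_neg_eq_add, Complex.add_re, Complex.one_re]
      nlinarith
    have b5 := (hC₂ p pre).trans (le_abs_self C₂)
    calc _ ≤ Real.pi / s * (|C₁| * Real.exp (-(A * ξ.re))) *
          (Real.exp (Real.pi * (T₂ / η)) / s' * |C₂|) := by gcongr
      _ = _ := by ring

lemma loopKernel_composed {η ν α : ℝ} (hη : 0 < η) (hα : 0 < α) {σ β μ : ℂ}
    (hσ : 1 / η - 1 < σ.re) :
    LoopKernel {c | -((β.re + rlOrder μ - μ.re) / α) < c ∧ -(β.re / α) < c}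
      (min 0 (-(η * σ.re + ν))) (η * |σ.im|)
      (foxKernel 2 2 (composedUpper η ν α β μ) (composedLower η σ ν α β μ)) := by
  have M := loopKernel_macdonald (ν := ν) hη hσ
  have re1 {c : ℝ} (hc : -((β.re + rlOrder μ - μ.re) / α) < c) {ξ : ℂ} (h : c ≤ ξ.re) :
      0 < (β + (rlOrder μ : ℂ) - μ + α * ξ).re := by
    have e1 : ((α : ℂ) * ξ).re = α * ξ.re := by simp
    rw [Complex.add_re, e1]
    simp only [Complex.sub_re, Complex.add_re, Complex.natCast_re]
    have := hc.trans_le h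
    rw [neg_lt, lt_div_iff₀ hα] at this
    linarith
  have re2 {c : ℝ} (hc : -(β.re / α) < c) {ξ : ℂ} (h : c ≤ ξ.re) : 0 < (β + α * ξ).re := by
    have e1 : ((α : ℂ) * ξ).re = α * ξ.re := by simp
    rw [Complex.add_re, e1]
    have := hc.trans_le h
    rw [← neg_div, div_lt_iff₀ hα] at this
    linarith
  have hd : ∀ c ∈ {c | -((β.re + rlOrder μ - μ.re) / α) < c ∧ -(β.re / α) < c}, ∀ ξ : ℂ,
      c ≤ ξ.re → (ξ.re < min 0 (-(η * σ.re + ν)) ∨ η * |σ.im| < |ξ.im|) → DifferentiableAt ℂ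
        (foxKernel 2 2 (composedUpper η ν α β μ) (composedLower η σ ν α β μ)) ξ := by
    intro c hc ξ h1 h2
    have hev : foxKernel 2 2 (composedUpper η ν α β μ) (composedLower η σ ν α β μ) =ᶠ[𝓝 ξ]
        fun ξ => foxKernel 2 0 (macdonaldUpper η ν) (macdonaldLower η σ ν) ξ *
          (Complex.Gamma (β + α * ξ) * (Complex.Gamma (β - μ + α * ξ))⁻¹) := by
      have ho : IsOpen {ξ : ℂ | 0 < (β + (rlOrder μ : ℂ) - μ + α * ξ).re} :=
        isOpen_lt continuous_const (by fun_prop)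
      filter_upwards [ho.mem_nhds (re1 hc.1 h1)] with ζ hζ
      exact foxKernel_composed η ν α σ β μ ζ hζ
    refine DifferentiableAt.congr_of_eventuallyEq ?_ hev
    refine (M.differentiableAt c trivial ξ h1 h2).mul (DifferentiableAt.mul
      (DifferentiableAt.comp ξ (Complex.differentiableAt_Gamma _ fun m hm => ?_) (by fun_prop))
      ((Complex.differentiable_one_div_Gamma.comp
        (f := fun x : ℂ => β - μ + α * x) (by fun_prop)) ξ))
    have := re2 hc.2 h1
    rw [hm] at this
    simp at this
    linarith [m.cast_nonneg (α := ℝ)]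
  refine ⟨M.nonneg, hd, fun c hc T₁ T₂ hT A hA => ?_⟩
  -- beyond this abscissa `β - μ + αξ` and `β + αξ` have real part at least `1`
  refine exists_decay_of_large (X := (1 + |(β - μ).re| + |β.re|) / α) (fun ξ h1 h2 =>
    (hd c hc ξ h1 (Or.inr (hT.trans_le h2))).continuousAt) ?_
  obtain ⟨n, hn⟩ := exists_nat_gt μ.re
  -- the extra rate `n * α` absorbs the growth of the quotient of Gamma factors
  obtain ⟨C₁, hC₁⟩ := M.decay c trivial T₁ T₂ hT (A + n * α) (by positivity)
  obtain ⟨C₂, hC₂⟩ := exists_norm_Gamma_add_mul_inv_Gamma_le n μ hn one_pos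
    (|(β - μ).im| + α * T₂)
  refine ⟨|C₁| * |C₂| * Real.exp (n * (β - μ).re), fun ξ h1 hX h2 h3 => ?_⟩
  have e1 : ((α : ℂ) * ξ).re = α * ξ.re := by simp
  have e2 : ((α : ℂ) * ξ).im = α * ξ.im := by simp
  rw [div_le_iff₀' hα] at hX
  have d := hC₂ (β - μ + α * ξ)
    (by rw [Complex.add_re, e1]; linarith [neg_abs_le (β - μ).re, abs_nonneg β.re])
    (by rw [show β - μ + α * ξ + μ = β + α * ξ by ring, Complex.add_re, e1]
        linarith [neg_abs_le β.re, abs_nonneg (β - μ).re])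
    (by rw [Complex.add_im, e2]
        refine (abs_add_le _ _).trans ?_
        rw [abs_mul, abs_of_pos hα]; gcongr)
  rw [show β - μ + α * ξ + μ = β + α * ξ by ring] at d
  rw [foxKernel_composed η ν α σ β μ ξ (re1 hc.1 h1), norm_mul]
  calc _ ≤ (|C₁| * Real.exp (-((A + n * α) * ξ.re))) *
        (|C₂| * Real.exp (n * (β - μ + α * ξ).re)) := by
        refine mul_le_mul ((hC₁ ξ h1 h2 h3).trans ?_) (d.trans ?_) (norm_nonneg _) (by positivity)
        · gcongr; exact le_abs_self _
        · gcongr; exact le_abs_self _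
    _ = |C₁| * |C₂| * Real.exp (-((A + n * α) * ξ.re) + n * (β - μ + α * ξ).re) := by
        rw [Real.exp_add]; ring
    _ = |C₁| * |C₂| * Real.exp (n * (β - μ).re + -(A * ξ.re)) := by
        rw [Complex.add_re, e1]; ring_nf
    _ = _ := by rw [Real.exp_add]; ring

/-! ### The operators -/

/-- The operator with the `H`-function kernel as a convolution on the line. The truncation of the
domain to `(a, b)` is harmless for `x ≤ b`. -/
lemma foxOperator_eq_volterra {p q m n : ℕ} {A : Fin p → ℂ × ℝ} {B : Fin q → ℂ × ℝ} {G ξ : ℝ → ℂ}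
    (hH : ∀ z : ℂ, z ≠ 0 → foxH m n A B z = ∫ y, G y * z ^ ξ y) {w : ℂ} (hw : w ≠ 0) (α : ℝ)
    (β : ℂ) (φ : ℝ → ℂ) {a b x : ℝ} (hx : x ∈ Set.Ioc a b)
    (hi : Integrable (fun t => mellinKer w α β G ξ (x - t) * (Set.Ioo a b).indicator φ t)) :
    IntervalIntegrable (foxIntegrand w m n α A B β φ x) volume a x ∧
      foxOperator a w m n α A B β φ x =
        volterra (mellinKer w α β G ξ) ((Set.Ioo a b).indicator φ) x := by
  have e : Set.EqOn (fun t => mellinKer w α β G ξ (x - t) * (Set.Ioo a b).indicator φ t)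
      (foxIntegrand w m n α A B β φ x) (Set.Ioo a x) := by
    intro t ht
    have ht' : 0 < x - t := sub_pos.2 ht.2
    have hz : w * (((x - t) ^ α : ℝ) : ℂ) ≠ 0 :=
      mul_ne_zero hw (Complex.ofReal_ne_zero.2 (by positivity))
    simp only [foxIntegrand, mellinKer, posPow, if_pos ht', hH _ hz]
    rw [Set.indicator_of_mem (s := Set.Ioo a b) ⟨ht.1, ht.2.trans_le hx.2⟩]
  constructor
  · rw [intervalIntegrable_iff_integrableOn_Ioo_of_le hx.1.le]
    exact hi.integrableOn.congr_fun e measurableSet_Ioo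
  · rw [foxOperator, intervalIntegral.integral_of_le hx.1.le, integral_Ioc_eq_integral_Ioo,
      ← setIntegral_congr_fun measurableSet_Ioo e, volterra]
    refine setIntegral_eq_integral_of_forall_compl_eq_zero fun t ht => ?_
    rcases le_or_gt t a with h1 | h1
    · rw [Set.indicator_of_notMem (fun h => h1.not_gt h.1), mul_zero]
    · have : ¬ 0 < x - t := fun h => ht ⟨h1, by linarith⟩
      simp [mellinKer, posPow, this]

/-- The identity holds, with absolute convergence, at every `x` where `|D^μ φ|` has a finite
convolution with `u ^ (Re β + αc - 1)`. Here `c` is the abscissa of a loop that is admissible for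
both `H`-functions. -/
lemma foxOperator_rlDeriv_eq {a b : ℝ} (hab : a < b) {μ β σ w : ℂ} {α η ν c : ℝ}
    (hμ : 0 < μ.re) (hw : w ≠ 0) (hα : 0 < α) (hη : 0 < η) (hσ : 1 / η - 1 < σ.re)
    (hcβ : 0 < (β - μ).re + α * c) (hc : c < min 0 (-(η * σ.re + ν)))
    {φ : ℝ → ℂ} (hφ : IsRLDifferentiable a b μ φ) {x : ℝ} (hx : x ∈ Set.Ioc a b)
    (hfin : ∫⁻ v, posPowE ((β - μ).re + α * c + μ.re) (x - v) *
      ‖(Set.Ioo a b).indicator (rlDeriv a μ φ) v‖ₑ < ⊤) :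
    IntervalIntegrable (foxIntegrand w 2 0 α (macdonaldUpper η ν) (macdonaldLower η σ ν)
        β (rlDeriv a μ φ) x) volume a x ∧
      IntervalIntegrable (foxIntegrand w 2 2 α (composedUpper η ν α β μ)
        (composedLower η σ ν α β μ) (β - μ) φ x) volume a x ∧
      foxOperator a w 2 0 α (macdonaldUpper η ν) (macdonaldLower η σ ν)
          β (rlDeriv a μ φ) x =
        foxOperator a w 2 2 α (composedUpper η ν α β μ) (composedLower η σ ν α β μ)
          (β - μ) φ x := by
  set T : ℝ := η * |σ.im| + 1 with hT
  have hTlt : η * |σ.im| < T := by rw [hT]; linarith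
  set S : Set ℝ := {c | -((β.re + rlOrder μ - μ.re) / α) < c ∧ -(β.re / α) < c} with hS
  have hcS : c ∈ S := by
    have hN : (0 : ℝ) ≤ rlOrder μ := by positivity
    rw [Complex.sub_re] at hcβ
    constructor
    · rw [neg_lt, lt_div_iff₀ hα]; linarith
    · rw [neg_lt, lt_div_iff₀ hα]; linarith
  have M := loopKernel_macdonald (ν := ν) hη hσ
  have P : LoopKernel S _ _ _ := loopKernel_composed (ν := ν) (β := β) (μ := μ) hη hα hσ
  set K₁ := foxKernel 2 0 (macdonaldUpper η ν) (macdonaldLower η σ ν) with hK₁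
  set K₂ := foxKernel 2 2 (composedUpper η ν α β μ) (composedLower η σ ν α β μ) with hK₂
  have H₁ (z : ℂ) (hz : z ≠ 0) := M.foxH_eq (c := c) (T := T)
    (fun c T h => ⟨trivial, (isFoxLoop_macdonald hη).1 h⟩)
    ((isFoxLoop_macdonald hη).2 ⟨hc, hTlt⟩) hz
  have H₂ (z : ℂ) (hz : z ≠ 0) := P.foxH_eq (c := c) (T := T)
    (fun c T h => (isFoxLoop_composed hη).1 h)
    ((isFoxLoop_composed hη).2 ⟨hcS, hc, hTlt⟩) hz
  have hre (y : ℝ) : 0 < (β - μ + α * loopPath c T y).re := by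
    have e1 : ((α : ℂ) * loopPath c T y).re = α * (loopPath c T y).re := by simp
    rw [Complex.add_re, e1]
    have := mul_le_mul_of_nonneg_left (le_loopPath_re c T y) hα.le
    linarith
  have hker : volterra (mellinKer w α (β - μ) (loopWeight K₂ c T) (loopPath c T)) (rlKer μ) =
      mellinKer w α β (loopWeight K₁ c T) (loopPath c T) := by
    rw [volterra_mellinKer_rlKer (P.measurable_loopWeight hcS hc hTlt)
      (continuous_loopPath c T).measurable (le_loopPath_re c T) hw hα
      (fun z hz => P.integrable_loopWeight hcS hc hTlt hz) hcβ hμ, sub_add_cancel]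
    congr 1
    ext y
    have h1 := Complex.Gamma_ne_zero_of_re_pos (hre y)
    have e2 : β - μ + α * loopPath c T y + μ = β + α * loopPath c T y := by ring
    have h2 : Complex.Gamma (β + α * loopPath c T y) ≠ 0 := by
      refine Complex.Gamma_ne_zero_of_re_pos ?_
      rw [← e2, Complex.add_re]; linarith [hre y]
    rw [e2, loopWeight, hK₂, foxKernel_composed, loopWeight]
    · generalize Complex.Gamma (β - μ + α * loopPath c T y) = X at h1 ⊢
      generalize Complex.Gamma (β + α * loopPath c T y) = Y at h2 ⊢
      rw [hK₁]
      field_simp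
    · have := hre y
      rw [show β + (rlOrder μ : ℂ) - μ + α * loopPath c T y =
        β - μ + α * loopPath c T y + (rlOrder μ : ℂ) by ring, Complex.add_re, Complex.natCast_re]
      positivity
  have hDi : Integrable ((Set.Ioo a b).indicator (rlDeriv a μ φ)) :=
    (integrable_indicator_iff measurableSet_Ioo).2 hφ.integrable_deriv
  have hDs : ∀ t ∉ Set.Ioo a b, (Set.Ioo a b).indicator (rlDeriv a μ φ) t = 0 :=
    fun t ht => Set.indicator_of_notMem ht _
  have hpb : PowerBound (b - a) ((β - μ).re + α * c)
      (mellinKer w α (β - μ) (loopWeight K₂ c T) (loopPath c T)) :=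
    powerBound_mellinKer (P.measurable_loopWeight hcS hc hTlt)
      (continuous_loopPath c T).measurable (le_loopPath_re c T) hw hα
      (fun z hz => P.integrable_loopWeight hcS hc hTlt hz) (β - μ) (sub_pos.2 hab)
  obtain ⟨a1, a2, a3⟩ :=
    hpb.volterra_assoc (powerBound_rlKer (b - a) μ) hcβ hμ hab hDi.1 hDs hx.2 hfin
  rw [hker] at a1 a3
  have hae : ∀ᵐ t ∂volume, mellinKer w α (β - μ) (loopWeight K₂ c T) (loopPath c T) (x - t) *
      volterra (rlKer μ) ((Set.Ioo a b).indicator (rlDeriv a μ φ)) t =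
      mellinKer w α (β - μ) (loopWeight K₂ c T) (loopPath c T) (x - t) *
        (Set.Ioo a b).indicator φ t := by
    have h := ae_eq_volterra_rlDeriv hab hμ hφ
    rw [ae_restrict_iff' measurableSet_Ioo] at h
    filter_upwards [h] with t ht
    rcases le_or_gt t a with h1 | h1
    · rw [volterra_eq_zero_of_le (fun u hu => rlKer_of_nonpos _ hu)
        (fun t ht => hDs t fun h => ht.not_gt h.1) h1,
        Set.indicator_of_notMem (fun h => h1.not_gt h.1)]
    rcases le_or_gt x t with h2 | h2
    · simp [mellinKer, posPow, h2.not_gt]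
    · have hm : t ∈ Set.Ioo a b := ⟨h1, h2.trans_le hx.2⟩
      rw [Set.indicator_of_mem hm φ, ht hm]
  obtain ⟨f1, g1⟩ := foxOperator_eq_volterra H₁ hw α β (rlDeriv a μ φ) hx a3
  obtain ⟨f2, g2⟩ := foxOperator_eq_volterra H₂ hw α (β - μ) φ hx (a2.congr hae)
  refine ⟨f1, f2, ?_⟩
  rw [g1, g2, ← a1]
  exact integral_congr_ae hae

theorem corollary5 (a b : ℝ) (hab : a < b) (μ β σ w : ℂ) (α η ν : ℝ)
    (hμ : 0 < μ.re) (hw : w ≠ 0) (hα : 0 < α) (hη : 0 < η) (hσ : 1 / η - 1 < σ.re)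
    (hβ : 0 < β.re)
    (hβb : 0 < β.re + α * min 0 (-(η * σ.re + ν)))
    (hβμ : 0 < (β - μ).re)
    (hβμb : 0 < (β - μ).re + α * min 0 (-(η * σ.re + ν)))
    (φ : ℝ → ℂ) (hφ : IsRLDifferentiable a b μ φ) :
    (∀ᵐ x ∂(volume.restrict (Set.Ioo a b)),
      IntervalIntegrable (foxIntegrand w 2 0 α (macdonaldUpper η ν) (macdonaldLower η σ ν)
        β (rlDeriv a μ φ) x) volume a x ∧
      IntervalIntegrable (foxIntegrand w 2 2 α (composedUpper η ν α β μ)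
        (composedLower η σ ν α β μ) (β - μ) φ x) volume a x ∧
      foxOperator a w 2 0 α (macdonaldUpper η ν) (macdonaldLower η σ ν)
          β (rlDeriv a μ φ) x =
        foxOperator a w 2 2 α (composedUpper η ν α β μ) (composedLower η σ ν α β μ)
          (β - μ) φ x) ∧
    (∀ x ∈ Set.Ioc a b,
      (∃ c ∈ Set.Ico a x, ∃ M : ℝ,
        ∀ᵐ t ∂(volume.restrict (Set.Ioo c x)), ‖rlDeriv a μ φ t‖ ≤ M) →
      IntervalIntegrable (foxIntegrand w 2 0 α (macdonaldUpper η ν) (macdonaldLower η σ ν)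
        β (rlDeriv a μ φ) x) volume a x ∧
      IntervalIntegrable (foxIntegrand w 2 2 α (composedUpper η ν α β μ)
        (composedLower η σ ν α β μ) (β - μ) φ x) volume a x ∧
      foxOperator a w 2 0 α (macdonaldUpper η ν) (macdonaldLower η σ ν)
          β (rlDeriv a μ φ) x =
        foxOperator a w 2 2 α (composedUpper η ν α β μ) (composedLower η σ ν α β μ)
          (β - μ) φ x) := by

  -- the abscissa of a loop on which `Re (β - μ + αξ) > 0`, to the left of the enclosed poles
  obtain ⟨c, hc1, hc2⟩ : ∃ c, -((β - μ).re / α) < c ∧ c < min 0 (-(η * σ.re + ν)) := by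
    refine exists_between ?_
    rw [neg_lt, lt_div_iff₀ hα]
    linarith
  have hcβ : 0 < (β - μ).re + α * c := by
    rw [neg_lt, lt_div_iff₀ hα] at hc1
    linarith
  have hDi : Integrable ((Set.Ioo a b).indicator (rlDeriv a μ φ)) :=
    (integrable_indicator_iff measurableSet_Ioo).2 hφ.integrable_deriv
  have hDs : ∀ t ∉ Set.Ioo a b, (Set.Ioo a b).indicator (rlDeriv a μ φ) t = 0 :=
    fun t ht => Set.indicator_of_notMem ht _
  have hr : 0 < (β - μ).re + α * c + μ.re := by linarith
  constructor
  · filter_upwards [ae_restrict_mem measurableSet_Ioo, ae_lintegral_posPowE_lt_top hr hDi hDs]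
      with x hx hfin
    exact foxOperator_rlDeriv_eq hab hμ hw hα hη hσ hcβ hc2 hφ ⟨hx.1, hx.2.le⟩ hfin
  · rintro x hx ⟨d, hd, M, hM⟩
    refine foxOperator_rlDeriv_eq hab hμ hw hα hη hσ hcβ hc2 hφ hx
      (lintegral_posPowE_lt_top_of_bounded hr hDi hDs hx.2 hd.2 (M := M) ?_)
    filter_upwards [hM, ae_restrict_mem measurableSet_Ioo] with t ht ht'
    rwa [Set.indicator_of_mem (s := Set.Ioo a b) ⟨hd.1.trans_lt ht'.1, ht'.2.trans_le hx.2⟩]
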